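/- **Conventions.** Let $e>1$ and $n\ge 0$ be integers. A bipartition $\lambda=(\lambda^{(0)},\lambda^{(1)})$ of rank $n$ is a pair of partitions of total size $n$; $\Pi_{2,n}$ is the set of these. For $s=(s_0,s_1)\in\mathbb Z^2$, a node $\gamma=(a,b,c)$ (row $a$, column $b$, component $c\in\{0,1\}$) has charged content $b-a+s_c$ and residue $b-a+s_c \bmod e$. On nodes of the same residue put $\gamma<_s\gamma'$ if $b-a+s_c<b'-a'+s_{c'}$, or $b-a+s_c=b'-a'+s_{c'}$ and $c'<c$. A removable $i$-node $\gamma$ of $\lambda$ is *normal* if for every addable $i$-node $\eta>_s\gamma$ there are more removable than addable $i$-nodes of $\lambda$ strictly between $\gamma$ and $\eta$; the minimal normal $i$-node (if any) is *good*. Write $\lambda\xrightarrow{\,i\,}_s\mu$ if $\mu$ is obtained from $\lambda$ by adding one node and this node is a good $i$-node of $\mu$. The set $\Phi^{s}_{e,n}$ of Uglov bipartitions consists of the bipartitions of rank $n$ reachable from $\boldsymbol\emptyset=(\emptyset,\emptyset)$ by such arrows. Let $s'\in\mathbb Z^2$ be such that, modulo $e$, $(s_0',s_1')\equiv(s_0,s_1)$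 or $(s_0',s_1')\equiv(s_1,s_0)$. The crystal bijection $\Psi_s^{s'}:\Phi^s_{e,n}\to\Phi^{s'}_{e,n}$ is given recursively by $\Psi_s^{s'}(\boldsymbol\emptyset)=\boldsymbol\emptyset$ and $\Psi_s^{s'}(\lambda)=\mu$ whenever $\lambda'\xrightarrow{\,i\,}_s\lambda$, $\mu'\xrightarrow{\,i\,}_{s'}\mu$ and $\Psi_s^{s'}(\lambda')=\mu'$ for some $i$. **The map $\Upsilon$.** Let $s=(s_0,s_1)\in\mathbb N^2$ with $s_0\le s_1$ and let $\lambda\in\Phi_{e,n}^s$, with $r_c$ the number of rows of $\lambda^{(c)}$. Choose $m\in\mathbb N$ with $m>\max(r_0-s_0,r_1-s_1)$. The $s$-symbol $S_s(\lambda)$ of $\lambda$ is the pair of sets $\beta^{(c)}=\{\lambda^{(c)}_j-j+s_c+m : 1\le j\le m+s_c\}$, $c=0,1$. Running through $\beta^{(0)}$ in increasing order, let $\theta(x)$ be the largest element of $\beta^{(1)}$ that is at most $x$ and is not yet a value of $\theta$. The $(x,\theta(x))$ with $\theta(x)\ne x$ are the pairs of the symbol. Exchange the two entries of every pair, that is,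 move $x$ to $\beta^{(1)}$ and $\theta(x)$ to $\beta^{(0)}$; $\Upsilon_{(s_0,s_1)}(\lambda)$ is the bipartition $\mu$ whose $s$-symbol (with the same $m$) is the result. **Theorem 4.1.** Let $e>1$ and $n\ge0$. 1. Let $(s_0,s_1)\in\mathbb N^2$ with $s_0\le s_1$. The recursive rule defines a bijection $\Psi_{(s_0,s_1)}^{(s_0,s_1+e)}:\Phi_{e,n}^{(s_0,s_1)}\to\Phi_{e,n}^{(s_0,s_1+e)}$, the map $\Upsilon_{(s_0,s_1)}$ is well defined on $\Phi_{e,n}^{(s_0,s_1)}$ and independent of $m$, and $$\Psi_{(s_0,s_1)}^{(s_0,s_1+e)}=\Upsilon_{(s_0,s_1)} .$$ 2. Consequently, for all $s,s'\in\mathbb Z^2$ with $(s_0',s_1')\equiv(s_0,s_1)$ or $(s_0',s_1')\equiv(s_1,s_0)$ modulo $e$, the recursive rule defines a bijection $\Psi_s^{s'}:\Phi_{e,n}^{s}\to\Phi_{e,n}^{s'}$, and it is a finite composite of bijections of the following kinds and their inverses: the identity map $\Phi_{e,n}^{(u_0,u_1)}\to\Phi_{e,n}^{(u_0+te,u_1+te)}$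 ($u_0,u_1,t\in\mathbb Z$); the exchange of components $(\lambda^{(0)},\lambda^{(1)})\mapsto(\lambda^{(1)},\lambda^{(0)})$ from $\Phi_{e,n}^{(u_0,u_1)}$ to $\Phi_{e,n}^{(u_1,u_0+e)}$ ($u_0,u_1\in\mathbb Z$); and $\Upsilon_{(u_0,u_1)}:\Phi_{e,n}^{(u_0,u_1)}\to\Phi_{e,n}^{(u_0,u_1+e)}$ ($u_0,u_1\in\mathbb N$, $u_0\le u_1$). -/

import Mathlib

namespace UglovCrystal

/-- A bipartition `(lam 0, lam 1)`, each component given by its Young diagram. -/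
abbrev Bipartition := Fin 2 → YoungDiagram

/-- The rank of a bipartition: its total number of nodes. -/
def rank (lam : Bipartition) : ℕ := (lam 0).card + (lam 1).card

/-- The empty bipartition. -/
def emptyBip : Bipartition := fun _ => ⊥

/-- A position `(a, b, c)`: row, column and component.  Rows and columns are counted
from `0`, which does not change the difference (column) - (row). -/
@[ext]
structure Node where
  row : ℕ
  col : ℕ
  comp : Fin 2

/-- The diagram `[lam]` of a bipartition. -/
def diagram (lam : Bipartition) : Set Node := {g | (g.row, g.col) ∈ lam g.comp}

/-- `[mu]` is obtained from `[lam]` by adding the single node `g`. -/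
def AddNode (lam : Bipartition) (g : Node) (mu : Bipartition) : Prop :=
  g ∉ diagram lam ∧ diagram mu = insert g (diagram lam)

/-- The charged content `b - a + s_c` of the node `(a, b, c)`. -/
def content (s : Fin 2 → ℤ) (g : Node) : ℤ := (g.col : ℤ) - (g.row : ℤ) + s g.comp

/-- The residue of a node, in `ℤ/eℤ`. -/
def res (e : ℕ) (s : Fin 2 → ℤ) (g : Node) : ZMod e := (content s g : ZMod e)

/-- The order `<_(s_0, s_1)` on nodes of the same residue. -/
def nodeLT (s : Fin 2 → ℤ) (g g' : Node) : Prop :=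
  content s g < content s g' ∨ (content s g = content s g' ∧ g'.comp < g.comp)

/-- `g` is an addable `i`-node of `lam`. -/
def IsAddable (e : ℕ) (s : Fin 2 → ℤ) (i : ZMod e) (lam : Bipartition) (g : Node) : Prop :=
  res e s g = i ∧ ∃ mu, AddNode lam g mu

/-- `g` is a removable `i`-node of `lam`. -/
def IsRemovable (e : ℕ) (s : Fin 2 → ℤ) (i : ZMod e) (lam : Bipartition) (g : Node) : Prop :=
  res e s g = i ∧ ∃ nu, AddNode nu g lam

/-- `g` is a normal `i`-node of `lam`: it is removable, and for every addable `i`-node `h > g`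
there are more removable than addable `i`-nodes strictly between `g` and `h`.
(Both sets of nodes between `g` and `h` are finite.)  Equivalently, `g` survives the
successive deletion of the pairs `RA` in the increasing sequence of removable and addable
`i`-nodes of `lam`. -/
def IsNormal (e : ℕ) (s : Fin 2 → ℤ) (i : ZMod e) (lam : Bipartition) (g : Node) : Prop :=
  IsRemovable e s i lam g ∧
    ∀ h, IsAddable e s i lam h → nodeLT s g h →
      {x | IsAddable e s i lam x ∧ nodeLT s g x ∧ nodeLT s x h}.ncard <
        {x | IsRemovable e s i lam x ∧ nodeLT s g x ∧ nodeLT s x h}.ncard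

/-- `g` is a good `i`-node of `lam`: the minimal normal `i`-node. -/
def IsGood (e : ℕ) (s : Fin 2 → ℤ) (i : ZMod e) (lam : Bipartition) (g : Node) : Prop :=
  IsNormal e s i lam g ∧ ∀ h, IsNormal e s i lam h → ¬ nodeLT s h g

/-- The arrow `lam → mu` of colour `i` in the crystal graph of the Fock space of charge `s`:
`[mu] / [lam]` is a good `i`-node of `mu`. -/
def Arrow (e : ℕ) (s : Fin 2 → ℤ) (i : ZMod e) (lam mu : Bipartition) : Prop :=
  ∃ g, AddNode lam g mu ∧ IsGood e s i mu g

/-- Uglov bipartitions of charge `s` (of arbitrary rank). -/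
inductive IsUglov (e : ℕ) (s : Fin 2 → ℤ) : Bipartition → Prop
  | empty : IsUglov e s emptyBip
  | step {lam mu : Bipartition} {i : ZMod e} :
      IsUglov e s lam → Arrow e s i lam mu → IsUglov e s mu

/-- The set `Φ_{e,n}^s` of Uglov bipartitions of rank `n`. -/
def UglovSet (e n : ℕ) (s : Fin 2 → ℤ) : Set Bipartition :=
  {lam | IsUglov e s lam ∧ rank lam = n}

/-- The recursive rule defining the crystal bijection `Ψ` from charge `s` to charge `s'`:
`Ψ ∅ = ∅`, and if `Ψ lam' = mu'`, then `Ψ lam = mu` whenever `lam` and `mu` are reached from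
`lam'` and `mu'` by arrows of the same colour (for the charges `s` and `s'`). -/
inductive CrystalRel (e : ℕ) (s s' : Fin 2 → ℤ) : Bipartition → Bipartition → Prop
  | empty : CrystalRel e s s' emptyBip emptyBip
  | step {lam' lam mu' mu : Bipartition} {i : ZMod e} :
      CrystalRel e s s' lam' mu' → Arrow e s i lam' lam → Arrow e s' i mu' mu →
        CrystalRel e s s' lam mu

/-- `Psi` is the crystal bijection `Ψ_s^{s'} : Φ_{e,n}^s → Φ_{e,n}^{s'}`: its graph is exactly
the relation given by the recursive rule.  In particular there is at most one such `Psi`. -/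
def IsCrystalBijection (e n : ℕ) (s s' : Fin 2 → ℤ)
    (Psi : UglovSet e n s ≃ UglovSet e n s') : Prop :=
  ∀ (lam : UglovSet e n s) (mu : Bipartition),
    CrystalRel e s s' (lam : Bipartition) mu ↔ ((Psi lam : Bipartition) = mu)

/-- The `m`-th shift is large enough to form the `(s0, s1)`-symbol of `lam`:
`m > max (r_0 - s_0, r_1 - s_1)`, where `r_c` is the number of rows of `lam c`. -/
def Admissible (s0 s1 m : ℕ) (lam : Bipartition) : Prop :=
  (lam 0).colLen 0 < m + s0 ∧ (lam 1).colLen 0 < m + s1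

/-- The set of the `k` distinct numbers `nu_j - j + k`, `1 ≤ j ≤ k` (here `j = i + 1`). -/
def betaSet (nu : YoungDiagram) (k : ℕ) : Finset ℕ :=
  (Finset.range k).image fun i => nu.rowLen i + (k - (i + 1))

/-- The `(s0, s1)`-symbol with shift `m`.  Its rows are strictly monotone sequences, kept as
finite sets; row `c` consists of the numbers `lam^(c)_j - j + s_c + m`, `1 ≤ j ≤ m + s_c`. -/
def symbol (s0 s1 m : ℕ) (lam : Bipartition) : Finset ℕ × Finset ℕ :=
  (betaSet (lam 0) (m + s0), betaSet (lam 1) (m + s1))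

/-- `θ` is the Leclerc-Miyachi matching of the symbol with rows `S.1 = β^(0)` and
`S.2 = β^(1)`: running through `β^(0)` in increasing order, `θ x` is the largest element of
`β^(1)` that is at most `x` and was not used before.  (The values of `θ` outside `β^(0)` are
irrelevant.) -/
def IsMatching (S : Finset ℕ × Finset ℕ) (θ : ℕ → ℕ) : Prop :=
  ∀ x ∈ S.1, IsGreatest {y | y ∈ S.2 ∧ y ≤ x ∧ ∀ x' ∈ S.1, x' < x → θ x' ≠ y} (θ x)

/-- The elements `x` of `β^(0)` such that `(x, θ x)` is a pair of the symbol. -/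
def pairTops (S : Finset ℕ × Finset ℕ) (θ : ℕ → ℕ) : Finset ℕ := S.1.filter fun x => θ x ≠ x

/-- The symbol obtained by exchanging the two entries of every pair. -/
def swapPairs (S : Finset ℕ × Finset ℕ) (θ : ℕ → ℕ) : Finset ℕ × Finset ℕ :=
  ((S.1 \ pairTops S θ) ∪ (pairTops S θ).image θ,
   (S.2 \ (pairTops S θ).image θ) ∪ pairTops S θ)

/-- `Υ_(s0, s1) lam = mu`, computed with symbols of shift `m`: the matching of the symbol of
`lam` exists, and swapping all its pairs gives the symbol of `mu`. -/
def IsUpsilon (s0 s1 m : ℕ) (lam mu : Bipartition) : Prop :=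
  Admissible s0 s1 m lam ∧ Admissible s0 s1 m mu ∧
    ∃ θ, IsMatching (symbol s0 s1 m lam) θ ∧
      symbol s0 s1 m mu = swapPairs (symbol s0 s1 m lam) θ

/-- Two charges which agree modulo `e`, up to exchanging the components. -/
def Linked (e : ℕ) (s s' : Fin 2 → ℤ) : Prop :=
  (s' 0 ≡ s 0 [ZMOD e] ∧ s' 1 ≡ s 1 [ZMOD e]) ∨ (s' 0 ≡ s 1 [ZMOD e] ∧ s' 1 ≡ s 0 [ZMOD e])

/-- The maps between sets of Uglov bipartitions of rank `n` that are finite composites of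
identities `(s_0, s_1) → (s_0 + te, s_1 + te)`, exchanges of the two components
`(s_0, s_1) → (s_1, s_0 + e)`, maps `Υ_(s_0, s_1)` with `0 ≤ s_0 ≤ s_1`, and inverses of
such maps. -/
inductive IsExplicit (e n : ℕ) :
    ∀ s s' : Fin 2 → ℤ, (UglovSet e n s ≃ UglovSet e n s') → Prop
  | shift (s : Fin 2 → ℤ) (t : ℤ) (f : UglovSet e n s ≃ UglovSet e n ![s 0 + t * e, s 1 + t * e])
      (hf : ∀ lam, (f lam : Bipartition) = (lam : Bipartition)) :
      IsExplicit e n s ![s 0 + t * e, s 1 + t * e] f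
  | exchange (s : Fin 2 → ℤ) (f : UglovSet e n s ≃ UglovSet e n ![s 1, s 0 + e])
      (hf : ∀ lam, (f lam : Bipartition) = ![(lam : Bipartition) 1, (lam : Bipartition) 0]) :
      IsExplicit e n s ![s 1, s 0 + e] f
  | upsilon (s0 s1 : ℕ) (hs : s0 ≤ s1)
      (f : UglovSet e n ![(s0 : ℤ), s1] ≃ UglovSet e n ![(s0 : ℤ), s1 + e])
      (hf : ∀ (lam : UglovSet e n ![(s0 : ℤ), s1]) (m : ℕ), Admissible s0 s1 m (lam : Bipartition) →
        IsUpsilon s0 s1 m (lam : Bipartition) (f lam : Bipartition)) :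
      IsExplicit e n ![(s0 : ℤ), s1] ![(s0 : ℤ), s1 + e] f
  | symm {s s' : Fin 2 → ℤ} {f : UglovSet e n s ≃ UglovSet e n s'} :
      IsExplicit e n s s' f → IsExplicit e n s' s f.symm
  | trans {s s' s'' : Fin 2 → ℤ} {f : UglovSet e n s ≃ UglovSet e n s'}
      {g : UglovSet e n s' ≃ UglovSet e n s''} :
      IsExplicit e n s s' f → IsExplicit e n s' s'' g → IsExplicit e n s s'' (f.trans g)

end UglovCrystal

/-! Encode each component as a Maya diagram shifted by its charge: adding a node of content `k`
moves one bead from `k - 1` to `k`. Fix a residue, the class of `k0`, and list its positions in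
increasing order, with letter `1` for an addable node, `-1` for a removable one and `0` otherwise.
The letters form blocks of two, one block for each content `k0 + t * e`, with component 1 before
component 0. Let `H` be a discrete antiderivative of this word. The node added by an arrow is
exactly the one at the first point where `H` attains its maximum (`arrow_iff`).

Passing from `(s0, s1)` to `(s0, s1 + e)` moves the component 1 letters forward by one block. After
a shift of the positions by one, the blocks correspond to the same contents for the old charge, and
only the order inside each block is reversed. The map `Υ` compensates for this reversal. Read the
beads of component 1 as opening brackets and those of component 0 as closing brackets: the
Leclerc-Miyachi matching is bracket matching, governed by the height function `D` that counts open
brackets. The exchange preserves the number of beads at each height, hence all block sums, and it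
preserves the set of blocks `+ -` (`Swaps.addRem_iff`). These are the only blocks in which `H` rises
above both of its end values, so the first maxima lie in the same block on both sides
(`FirstMax.exists_of_blocks`). A local check shows that moving the two beads selected there keeps
the diagrams related by the exchange (`Swaps.move`).

Thus `UpsilonRel` relates the empty bipartition to itself, is compatible with arrows in both
directions, and is one-to-one: it is a correspondence of crystals (`isBisim_upsilonRel`). Any such
correspondence restricts to the crystal bijection on Uglov bipartitions. In particular `D` stays
nonnegative along arrows from the empty bipartition, which is why the matching always exists;
`UpsilonRel.isUpsilon` translates the result back to finite symbols, for every admissible shift.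

For the second part, shifting both charges by a multiple of `e` does not change the crystal, and
exchanging components only translates the signature by one position. Compositions of these
correspondences with `Υ` reach all linked charges (`connected_of_linked`). -/

namespace UglovCrystal

/-! ### Maya diagrams -/

/-- The Maya diagram of a partition: the numbers `nu_j - j`, with `j ≥ 1`. -/
def maya (nu : YoungDiagram) : Set ℤ := {k | ∃ j : ℕ, k = (nu.rowLen j : ℤ) - j - 1}

/-- The Maya diagram of the component `c` of a bipartition, shifted by the charge. -/
def bead (s : Fin 2 → ℤ) (lam : Bipartition) (c : Fin 2) : Set ℤ := {k | k - s c ∈ maya (lam c)}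

lemma rowLen_sub_strictAnti (nu : YoungDiagram) :
    StrictAnti fun j : ℕ => (nu.rowLen j : ℤ) - j - 1 := by
  intro i j hij
  have := nu.rowLen_anti i j hij.le
  simp only
  omega

lemma youngDiagram_ext_rowLen {nu nu' : YoungDiagram} (h : ∀ j, nu.rowLen j = nu'.rowLen j) :
    nu = nu' := by
  ext ⟨a, b⟩
  rw [YoungDiagram.mem_cells, YoungDiagram.mem_cells, YoungDiagram.mem_iff_lt_rowLen,
    YoungDiagram.mem_iff_lt_rowLen, h]

/-- A strictly decreasing sequence is determined by its range; the signs are reversed to use the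
statement for increasing sequences. -/
lemma maya_injective : Function.Injective maya := by
  intro nu nu' h
  have key : (fun j : ℕ => -((nu.rowLen j : ℤ) - j - 1)) =
      fun j : ℕ => -((nu'.rowLen j : ℤ) - j - 1) := by
    refine (StrictMono.range_inj (fun i j hij => ?_) (fun i j hij => ?_)).1 ?_
    · exact neg_lt_neg (rowLen_sub_strictAnti nu hij)
    · exact neg_lt_neg (rowLen_sub_strictAnti nu' hij)
    · ext x
      have h1 : -x ∈ maya nu ↔ -x ∈ maya nu' := by rw [h]
      simp only [maya, Set.mem_ofPred_eq] at h1
      simp only [Set.mem_range]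
      constructor
      · rintro ⟨j, hj⟩
        obtain ⟨j', hj'⟩ := h1.1 ⟨j, by omega⟩
        exact ⟨j', by omega⟩
      · rintro ⟨j, hj⟩
        obtain ⟨j', hj'⟩ := h1.2 ⟨j, by omega⟩
        exact ⟨j', by omega⟩
  refine youngDiagram_ext_rowLen fun j => ?_
  have := congrFun key j
  omega

lemma bead_injective (s : Fin 2 → ℤ) {lam mu : Bipartition}
    (h : ∀ c k, k ∈ bead s lam c ↔ k ∈ bead s mu c) : lam = mu := by
  funext c
  apply maya_injective
  ext k
  have := h c (k + s c)
  simpa [bead] using this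

lemma rowLen_bot (j : ℕ) : (⊥ : YoungDiagram).rowLen j = 0 := by
  by_contra h
  have : (j, 0) ∈ (⊥ : YoungDiagram) := YoungDiagram.mem_iff_lt_rowLen.2 (Nat.pos_of_ne_zero h)
  exact YoungDiagram.notMem_bot _ this

lemma mem_bead_empty (s : Fin 2 → ℤ) (c : Fin 2) (k : ℤ) :
    k ∈ bead s emptyBip c ↔ k < s c := by
  simp only [bead, maya, emptyBip, Set.mem_ofPred_eq, rowLen_bot]
  constructor
  · rintro ⟨j, hj⟩
    omega
  · intro h
    exact ⟨(s c - k - 1).toNat, by omega⟩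

/-! ### Adding a node in terms of rows -/

lemma addNode_iff {lam mu : Bipartition} {g : Node} :
    AddNode lam g mu ↔ g.col = (lam g.comp).rowLen g.row ∧
      (mu g.comp).rowLen g.row = (lam g.comp).rowLen g.row + 1 ∧
      ∀ c j, ¬ (c = g.comp ∧ j = g.row) → (mu c).rowLen j = (lam c).rowLen j := by
  obtain ⟨a, b, c⟩ := g
  have hmem : ∀ (nu : Bipartition) (a b : ℕ) (c : Fin 2),
      (⟨a, b, c⟩ : Node) ∈ diagram nu ↔ b < (nu c).rowLen a := fun nu a b c =>
    YoungDiagram.mem_iff_lt_rowLen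
  constructor
  · rintro ⟨h1, h2⟩
    rw [hmem] at h1
    have h3 : ∀ a' b' c', b' < (mu c').rowLen a' ↔
        (a' = a ∧ b' = b ∧ c' = c) ∨ b' < (lam c').rowLen a' := by
      intro a' b' c'
      rw [← hmem, ← hmem, h2, Set.mem_insert_iff, Node.mk.injEq]
    have hb := h3 a b c
    have hb' := h3 a ((lam c).rowLen a) c
    have hb'' := h3 a ((lam c).rowLen a + 1) c
    have hb3 := h3 a (b + 1) c
    refine ⟨by simp at *; omega, by simp at *; omega, fun c' j hj => ?_⟩
    have h4 : ∀ b', b' < (mu c').rowLen j ↔ b' < (lam c').rowLen j := by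
      intro b'
      rw [h3]
      constructor
      · rintro (h | h)
        · exact absurd ⟨h.2.2, h.1⟩ hj
        · exact h
      · exact Or.inr
    have := h4 ((mu c').rowLen j)
    have := h4 ((lam c').rowLen j)
    omega
  · rintro ⟨h1, h2, h3⟩
    simp only at h1 h2 h3
    refine ⟨by rw [hmem]; omega, ?_⟩
    ext ⟨a', b', c'⟩
    rw [Set.mem_insert_iff, hmem, hmem, Node.mk.injEq]
    by_cases h : c' = c ∧ a' = a
    · obtain ⟨rfl, rfl⟩ := h
      rw [h2]
      simp
      omega
    · rw [h3 c' a' h]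
      constructor
      · exact Or.inr
      · rintro (h' | h')
        · exact absurd ⟨h'.2.2, h'.1⟩ h
        · exact h'

lemma exists_addNode_of_rowLen_lt (lam : Bipartition) (c : Fin 2) (a : ℕ)
    (h : ∀ j, j < a → (lam c).rowLen a < (lam c).rowLen j) :
    ∃ mu, AddNode lam ⟨a, (lam c).rowLen a, c⟩ mu := by
  let nu : YoungDiagram :=
    { cells := insert (a, (lam c).rowLen a) (lam c).cells
      isLowerSet := by
        rintro ⟨x, y⟩ ⟨x', y'⟩ hle hx
        simp only [Finset.coe_insert, Set.mem_insert_iff, Prod.mk.injEq, Finset.mem_coe,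
          YoungDiagram.mem_cells] at hx ⊢
        obtain ⟨hx1, hy1⟩ := Prod.mk_le_mk.1 hle
        rcases hx with ⟨rfl, rfl⟩ | hx
        · by_cases hxx : x' = x
          · subst hxx
            rw [YoungDiagram.mem_iff_lt_rowLen]
            omega
          · right
            have := h x' (by omega)
            rw [YoungDiagram.mem_iff_lt_rowLen]
            omega
        · exact Or.inr (YoungDiagram.up_left_mem _ hx1 hy1 hx) }
  refine ⟨Function.update lam c nu, ?_, ?_⟩
  · change (a, (lam c).rowLen a) ∉ lam c
    rw [YoungDiagram.mem_iff_lt_rowLen]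
    omega
  · ext ⟨x, y, d⟩
    rw [Set.mem_insert_iff, Node.mk.injEq]
    change (x, y) ∈ Function.update lam c nu d ↔ _ ∨ (x, y) ∈ lam d
    by_cases hd : d = c
    · subst hd
      rw [Function.update_self, ← YoungDiagram.mem_cells]
      change (x, y) ∈ insert (a, (lam d).rowLen a) (lam d).cells ↔ _
      rw [Finset.mem_insert, Prod.mk.injEq, YoungDiagram.mem_cells]
      tauto
    · rw [Function.update_of_ne hd]
      tauto

lemma exists_addNode_to_of_rowLen_lt (mu : Bipartition) (c : Fin 2) (a : ℕ)
    (h : ∀ j, a < j → (mu c).rowLen j < (mu c).rowLen a) :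
    ∃ lam, AddNode lam ⟨a, (mu c).rowLen a - 1, c⟩ mu := by
  have hpos : 0 < (mu c).rowLen a := (Nat.zero_le _).trans_lt (h (a + 1) (by omega))
  let nu : YoungDiagram :=
    { cells := (mu c).cells.erase (a, (mu c).rowLen a - 1)
      isLowerSet := by
        rintro ⟨x, y⟩ ⟨x', y'⟩ hle hx
        simp only [Finset.coe_erase, Set.mem_sdiff, Set.mem_singleton_iff, Prod.mk.injEq,
          Finset.mem_coe, YoungDiagram.mem_cells] at hx ⊢
        obtain ⟨hx1, hy1⟩ := Prod.mk_le_mk.1 hle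
        refine ⟨YoungDiagram.up_left_mem _ hx1 hy1 hx.1, ?_⟩
        rintro ⟨rfl, rfl⟩
        have h1 := YoungDiagram.mem_iff_lt_rowLen.1 hx.1
        apply hx.2
        by_cases hxx : x = x'
        · subst hxx
          omega
        · have := h x (by omega)
          omega }
  refine ⟨Function.update mu c nu, ?_, ?_⟩
  · change (a, (mu c).rowLen a - 1) ∉ Function.update mu c nu c
    rw [Function.update_self, ← YoungDiagram.mem_cells]
    exact Finset.notMem_erase _ _
  · ext ⟨x, y, d⟩
    rw [Set.mem_insert_iff, Node.mk.injEq]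
    change (x, y) ∈ mu d ↔ _ ∨ (x, y) ∈ Function.update mu c nu d
    by_cases hd : d = c
    · subst hd
      rw [Function.update_self, ← YoungDiagram.mem_cells (μ := nu)]
      change _ ↔ _ ∨ (x, y) ∈ (mu d).cells.erase (a, (mu d).rowLen a - 1)
      rw [Finset.mem_erase, ne_eq, Prod.mk.injEq, YoungDiagram.mem_cells]
      constructor
      · intro hxy
        by_cases h' : x = a ∧ y = (mu d).rowLen a - 1
        · exact Or.inl ⟨h'.1, h'.2, rfl⟩
        · exact Or.inr ⟨h', hxy⟩
      · rintro (⟨rfl, rfl, -⟩ | h')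
        · rw [YoungDiagram.mem_iff_lt_rowLen]
          omega
        · exact h'.2
    · rw [Function.update_of_ne hd]
      tauto

/-! ### Adding a node in terms of beads -/

section
variable {s : Fin 2 → ℤ} {lam mu : Bipartition} {g : Node}

lemma AddNode.mem_bead_pred (h : AddNode lam g mu) : content s g - 1 ∈ bead s lam g.comp := by
  refine ⟨g.row, ?_⟩
  have := (addNode_iff.1 h).1
  simp only [content]
  omega

lemma AddNode.mem_bead_iff (h : AddNode lam g mu) (c : Fin 2) (k : ℤ) :
    k ∈ bead s mu c ↔ (c = g.comp ∧ k = content s g) ∨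
      (k ∈ bead s lam c ∧ ¬ (c = g.comp ∧ k = content s g - 1)) := by
  obtain ⟨h1, h2, h3⟩ := addNode_iff.1 h
  simp only [content]
  constructor
  · rintro ⟨j, hj⟩
    by_cases hcj : c = g.comp ∧ j = g.row
    · obtain ⟨rfl, rfl⟩ := hcj
      left
      exact ⟨rfl, by omega⟩
    · right
      rw [h3 c j hcj] at hj
      refine ⟨⟨j, hj⟩, ?_⟩
      rintro ⟨rfl, rfl⟩
      have : j ≠ g.row := fun h => hcj ⟨rfl, h⟩
      refine this ((rowLen_sub_strictAnti (lam g.comp)).injective ?_)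
      omega
  · rintro (⟨rfl, rfl⟩ | ⟨⟨j, hj⟩, hne⟩)
    · exact ⟨g.row, by omega⟩
    · by_cases hcj : c = g.comp ∧ j = g.row
      · obtain ⟨rfl, rfl⟩ := hcj
        exact absurd ⟨rfl, by omega⟩ hne
      · refine ⟨j, ?_⟩
        rw [h3 c j hcj]
        exact hj

lemma AddNode.notMem_bead (h : AddNode lam g mu) : content s g ∉ bead s lam g.comp := by
  rintro ⟨j, hj⟩
  obtain ⟨h1, h2, h3⟩ := addNode_iff.1 h
  simp only [content] at hj
  have hlt : j < g.row := by
    by_contra hle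
    have := (lam g.comp).rowLen_anti g.row j (by omega)
    omega
  have h4 := h3 g.comp j (by omega)
  have h5 := (mu g.comp).rowLen_anti j g.row hlt.le
  omega

lemma AddNode.mem_bead (h : AddNode lam g mu) : content s g ∈ bead s mu g.comp := by
  rw [h.mem_bead_iff]
  exact Or.inl ⟨rfl, rfl⟩

lemma AddNode.notMem_bead_pred (h : AddNode lam g mu) :
    content s g - 1 ∉ bead s mu g.comp := by
  rw [h.mem_bead_iff]
  rintro (h' | h')
  · omega
  · exact h'.2 ⟨rfl, rfl⟩

end

lemma exists_addNode (s : Fin 2 → ℤ) {lam : Bipartition} {c : Fin 2} {k : ℤ}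
    (h1 : k - 1 ∈ bead s lam c) (h2 : k ∉ bead s lam c) :
    ∃ g mu, AddNode lam g mu ∧ g.comp = c ∧ content s g = k := by
  -- If row `a - 1` were as short as row `a`, its bead would occupy `k`.
  obtain ⟨a, ha⟩ := h1
  obtain ⟨mu, hmu⟩ := exists_addNode_of_rowLen_lt lam c a (by
    intro j hj
    by_contra hle
    have e1 := (lam c).rowLen_anti j (a - 1) (by omega)
    have e2 := (lam c).rowLen_anti (a - 1) a (by omega)
    exact h2 ⟨a - 1, by omega⟩)
  exact ⟨_, mu, hmu, rfl, by simp only [content]; omega⟩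

lemma exists_addNode_to (s : Fin 2 → ℤ) {mu : Bipartition} {c : Fin 2} {k : ℤ}
    (h1 : k ∈ bead s mu c) (h2 : k - 1 ∉ bead s mu c) :
    ∃ g lam, AddNode lam g mu ∧ g.comp = c ∧ content s g = k := by
  obtain ⟨a, ha⟩ := h1
  have h3 : ∀ j, a < j → (mu c).rowLen j < (mu c).rowLen a := by
    intro j hj
    by_contra hle
    have e1 := (mu c).rowLen_anti a (a + 1) (by omega)
    have e2 := (mu c).rowLen_anti (a + 1) j (by omega)
    exact h2 ⟨a + 1, by omega⟩
  obtain ⟨lam, hlam⟩ := exists_addNode_to_of_rowLen_lt mu c a h3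
  have := h3 (a + 1) (by omega)
  exact ⟨_, lam, hlam, rfl, by simp only [content]; omega⟩

lemma AddNode.node_unique {s : Fin 2 → ℤ} {lam mu mu' : Bipartition} {g g' : Node}
    (h : AddNode lam g mu) (h' : AddNode lam g' mu') (hc : g.comp = g'.comp)
    (hk : content s g = content s g') : g = g' := by
  have e1 := (addNode_iff.1 h).1
  have e2 := (addNode_iff.1 h').1
  obtain ⟨a, b, c⟩ := g
  obtain ⟨a', b', c'⟩ := g'
  simp only [content] at *
  subst hc
  have : a = a' := (rowLen_sub_strictAnti (lam c)).injective (by omega)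
  subst this
  rw [e1, e2]

lemma AddNode.node_unique_to {s : Fin 2 → ℤ} {lam lam' mu : Bipartition} {g g' : Node}
    (h : AddNode lam g mu) (h' : AddNode lam' g' mu) (hc : g.comp = g'.comp)
    (hk : content s g = content s g') : g = g' := by
  obtain ⟨e1, f1, -⟩ := addNode_iff.1 h
  obtain ⟨e2, f2, -⟩ := addNode_iff.1 h'
  obtain ⟨a, b, c⟩ := g
  obtain ⟨a', b', c'⟩ := g'
  simp only [content] at *
  subst hc
  have : a = a' := (rowLen_sub_strictAnti (mu c)).injective (by omega)
  subst this
  congr 1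
  omega

lemma AddNode.target_unique {lam mu mu' : Bipartition} {g : Node}
    (h : AddNode lam g mu) (h' : AddNode lam g mu') : mu = mu' := by
  refine bead_injective 0 fun c k => ?_
  rw [h.mem_bead_iff, h'.mem_bead_iff]

lemma AddNode.rank_eq {lam mu : Bipartition} {g : Node} (h : AddNode lam g mu) :
    rank mu = rank lam + 1 := by
  obtain ⟨h1, h2⟩ := h
  obtain ⟨a, b, c⟩ := g
  have hcell : ∀ (d : Fin 2) (x : ℕ × ℕ), x ∈ (mu d).cells ↔
      (d = c ∧ x = (a, b)) ∨ x ∈ (lam d).cells := by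
    rintro d ⟨x, y⟩
    have : (⟨x, y, d⟩ : Node) ∈ diagram mu ↔ (⟨x, y, d⟩ : Node) ∈ insert ⟨a, b, c⟩ (diagram lam) := by
      rw [h2]
    rw [Set.mem_insert_iff, Node.mk.injEq] at this
    change (x, y) ∈ mu d ↔ _ ∨ (x, y) ∈ lam d at this
    rw [YoungDiagram.mem_cells, YoungDiagram.mem_cells, this, Prod.mk.injEq]
    tauto
  have hc : (mu c).cells = insert (a, b) (lam c).cells := by
    ext x
    rw [hcell, Finset.mem_insert]
    simp
  have hd : ∀ d, d ≠ c → (mu d).cells = (lam d).cells := by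
    intro d hd
    ext x
    rw [hcell]
    simp [hd]
  have hcard : (mu c).card = (lam c).card + 1 := by
    change (mu c).cells.card = (lam c).cells.card + 1
    rw [hc]
    exact Finset.card_insert_of_notMem h1
  have hcard' : ∀ d, d ≠ c → (mu d).card = (lam d).card := by
    intro d h
    change (mu d).cells.card = (lam d).cells.card
    rw [hd d h]
  unfold rank
  fin_cases c
  · have := hcard' 1 (by decide)
    simp only [Fin.zero_eta] at hcard
    omega
  · have := hcard' 0 (by decide)
    simp only [Fin.mk_one] at hcard
    omega

/-! ### Signatures -/

open Classical in
/-- The indicator of a proposition, as an integer. -/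
noncomputable def ind (P : Prop) : ℤ := if P then 1 else 0

lemma ind_of {P : Prop} (h : P) : ind P = 1 := if_pos h

lemma ind_congr {P Q : Prop} (h : P ↔ Q) : ind P = ind Q := by rw [propext h]

lemma ind_of_not {P : Prop} (h : ¬ P) : ind P = 0 := if_neg h

/-- `1` if there is an addable node of content `k` in component `c`, `-1` if there is a
removable one, and `0` otherwise. -/
noncomputable def beadSign (s : Fin 2 → ℤ) (lam : Bipartition) (c : Fin 2) (k : ℤ) : ℤ :=
  ind (k - 1 ∈ bead s lam c) - ind (k ∈ bead s lam c)

/-- The component of the nodes at position `p` of the increasing sequence of `i`-nodes. -/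
def posComp (p : ℤ) : Fin 2 := if p % 2 = 0 then 1 else 0

/-- The content of the nodes at position `p` of the increasing sequence of `i`-nodes. -/
def posContent (e : ℕ) (k0 p : ℤ) : ℤ := k0 + (p / 2) * e

/-- The position of a node in the increasing sequence of `i`-nodes, `i` being the class
of `k0`. -/
def pos (e : ℕ) (s : Fin 2 → ℤ) (k0 : ℤ) (g : Node) : ℤ :=
  2 * ((content s g - k0) / e) + if g.comp = 1 then 0 else 1

/-- The signature of a bipartition: the signs of the nodes of residue `k0`, in increasing
order. -/
noncomputable def word (e : ℕ) (s : Fin 2 → ℤ) (k0 : ℤ) (lam : Bipartition) (p : ℤ) : ℤ :=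
  beadSign s lam (posComp p) (posContent e k0 p)

/-- `H` is a discrete antiderivative of `w`. -/
def IsPrefix (H w : ℤ → ℤ) : Prop := ∀ p, H p - H (p - 1) = w p

/-- `p` is the first point where `H` attains its maximum. -/
def FirstMax (H : ℤ → ℤ) (p : ℤ) : Prop := (∀ x < p, H x < H p) ∧ ∀ x, p ≤ x → H x ≤ H p

lemma FirstMax.unique {H : ℤ → ℤ} {p q : ℤ} (hp : FirstMax H p) (hq : FirstMax H q) : p = q := by
  rcases lt_trichotomy p q with h | h | h
  · exact absurd (hq.1 p h) (not_lt.2 (hp.2 q h.le))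
  · exact h
  · exact absurd (hp.1 q h) (not_lt.2 (hq.2 p h.le))

lemma exists_isPrefix (w : ℤ → ℤ) : ∃ H, IsPrefix H w := by
  refine ⟨fun n => ∑ i ∈ Finset.Ioc 0 n, w i - ∑ i ∈ Finset.Ioc n 0, w i, fun p => ?_⟩
  rcases le_or_gt p 0 with h | h
  · have e1 : Finset.Ioc (p - 1) 0 = insert p (Finset.Ioc p 0) := by
      ext x
      simp only [Finset.mem_Ioc, Finset.mem_insert]
      omega
    have e2 : Finset.Ioc 0 p = ∅ := Finset.Ioc_eq_empty (by omega)
    have e3 : Finset.Ioc 0 (p - 1) = ∅ := Finset.Ioc_eq_empty (by omega)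
    simp only [e1, e2, e3]
    rw [Finset.sum_insert (by simp)]
    simp
  · have e1 : Finset.Ioc 0 p = insert p (Finset.Ioc 0 (p - 1)) := by
      ext x
      simp only [Finset.mem_Ioc, Finset.mem_insert]
      omega
    have e2 : Finset.Ioc p 0 = ∅ := Finset.Ioc_eq_empty (by omega)
    have e3 : Finset.Ioc (p - 1) 0 = ∅ := Finset.Ioc_eq_empty (by omega)
    simp only [e1, e2, e3]
    rw [Finset.sum_insert (by simp)]
    simp

lemma beadSign_cases (s : Fin 2 → ℤ) (lam : Bipartition) (c : Fin 2) (k : ℤ) :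
    beadSign s lam c k = 1 ∨ beadSign s lam c k = 0 ∨ beadSign s lam c k = -1 := by
  unfold beadSign ind
  split_ifs <;> simp

lemma beadSign_eq_one {s : Fin 2 → ℤ} {lam : Bipartition} {c : Fin 2} {k : ℤ} :
    beadSign s lam c k = 1 ↔ k - 1 ∈ bead s lam c ∧ k ∉ bead s lam c := by
  unfold beadSign ind
  split_ifs <;> simp [*]

lemma beadSign_eq_neg_one {s : Fin 2 → ℤ} {lam : Bipartition} {c : Fin 2} {k : ℤ} :
    beadSign s lam c k = -1 ↔ k ∈ bead s lam c ∧ k - 1 ∉ bead s lam c := by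
  unfold beadSign ind
  split_ifs <;> simp [*]

section
variable {e : ℕ} {s : Fin 2 → ℤ} {k0 : ℤ}

lemma posComp_pos (g : Node) : posComp (pos e s k0 g) = g.comp := by
  obtain ⟨a, b, c⟩ := g
  unfold posComp pos
  fin_cases c <;> simp

lemma posContent_pos {g : Node} (h : res e s g = (k0 : ZMod e)) :
    posContent e k0 (pos e s k0 g) = content s g := by
  have hdvd : (e : ℤ) ∣ content s g - k0 := by
    rw [← ZMod.intCast_eq_intCast_iff_dvd_sub]
    exact h.symm
  have h2 : pos e s k0 g / 2 = (content s g - k0) / e := by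
    unfold pos
    split_ifs <;> omega
  unfold posContent
  rw [h2, Int.ediv_mul_cancel hdvd]
  ring

lemma res_eq_of_content {g : Node} {p : ℤ} (h : content s g = posContent e k0 p) :
    res e s g = (k0 : ZMod e) := by
  unfold res
  rw [h]
  simp [posContent]

variable {lam mu : Bipartition}

lemma IsAddable.word_pos {g : Node} (h : IsAddable e s (k0 : ZMod e) lam g) :
    word e s k0 lam (pos e s k0 g) = 1 := by
  obtain ⟨h1, nu, h2⟩ := h
  unfold word
  rw [posContent_pos h1, posComp_pos, beadSign_eq_one]
  exact ⟨h2.mem_bead_pred, h2.notMem_bead⟩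

lemma IsRemovable.word_pos {g : Node} (h : IsRemovable e s (k0 : ZMod e) lam g) :
    word e s k0 lam (pos e s k0 g) = -1 := by
  obtain ⟨h1, nu, h2⟩ := h
  unfold word
  rw [posContent_pos h1, posComp_pos, beadSign_eq_neg_one]
  exact ⟨h2.mem_bead, h2.notMem_bead_pred⟩

lemma isAddable_pos_injective {g g' : Node} (h : IsAddable e s (k0 : ZMod e) lam g)
    (h' : IsAddable e s (k0 : ZMod e) lam g') (hp : pos e s k0 g = pos e s k0 g') : g = g' := by
  obtain ⟨h1, nu, h2⟩ := h
  obtain ⟨h1', nu', h2'⟩ := h'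
  refine h2.node_unique (s := s) h2' ?_ ?_
  · rw [← posComp_pos (e := e) (s := s) (k0 := k0) g, hp, posComp_pos]
  · rw [← posContent_pos h1, hp, posContent_pos h1']

lemma isRemovable_pos_injective {g g' : Node} (h : IsRemovable e s (k0 : ZMod e) lam g)
    (h' : IsRemovable e s (k0 : ZMod e) lam g') (hp : pos e s k0 g = pos e s k0 g') :
    g = g' := by
  obtain ⟨h1, nu, h2⟩ := h
  obtain ⟨h1', nu', h2'⟩ := h'
  refine h2.node_unique_to (s := s) h2' ?_ ?_
  · rw [← posComp_pos (e := e) (s := s) (k0 := k0) g, hp, posComp_pos]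
  · rw [← posContent_pos h1, hp, posContent_pos h1']

variable (he : 1 < e)
include he

lemma pos_eq {g : Node} {p : ℤ} (hc : g.comp = posComp p) (h : content s g = posContent e k0 p) :
    pos e s k0 g = p := by
  unfold pos
  rw [hc, h]
  have : (posContent e k0 p - k0) / (e : ℤ) = p / 2 := by
    unfold posContent
    rw [add_sub_cancel_left, Int.mul_ediv_cancel _ (by omega)]
  rw [this]
  unfold posComp
  split_ifs <;> simp_all <;> omega

lemma nodeLT_iff_pos_lt {g g' : Node} (h : res e s g = (k0 : ZMod e))
    (h' : res e s g' = (k0 : ZMod e)) :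
    nodeLT s g g' ↔ pos e s k0 g < pos e s k0 g' := by
  have e1 := posContent_pos h
  have e2 := posContent_pos h'
  have c1 := posComp_pos (e := e) (s := s) (k0 := k0) g
  have c2 := posComp_pos (e := e) (s := s) (k0 := k0) g'
  unfold nodeLT
  rw [← e1, ← e2, ← c1, ← c2]
  generalize pos e s k0 g = p
  generalize pos e s k0 g' = q
  have hlt : posContent e k0 p < posContent e k0 q ↔ p / 2 < q / 2 := by
    unfold posContent
    rw [add_lt_add_iff_left, mul_lt_mul_iff_of_pos_right (by omega)]
  have heq : posContent e k0 p = posContent e k0 q ↔ p / 2 = q / 2 := by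
    unfold posContent
    rw [add_right_inj, mul_eq_mul_right_iff]
    constructor
    · rintro (h | h)
      · exact h
      · omega
    · exact Or.inl
  rw [hlt, heq]
  unfold posComp
  split_ifs <;> simp <;> omega

lemma exists_addNode_of_word {p : ℤ} (h : word e s k0 lam p = 1) :
    ∃ g mu, AddNode lam g mu ∧ res e s g = (k0 : ZMod e) ∧ pos e s k0 g = p := by
  unfold word at h
  rw [beadSign_eq_one] at h
  obtain ⟨g, mu, h1, h2, h3⟩ := exists_addNode s h.1 h.2
  exact ⟨g, mu, h1, res_eq_of_content h3, pos_eq he h2 h3⟩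

lemma exists_isAddable_of_word {p : ℤ} (h : word e s k0 lam p = 1) :
    ∃ g, IsAddable e s (k0 : ZMod e) lam g ∧ pos e s k0 g = p := by
  obtain ⟨g, mu, h1, h2, h3⟩ := exists_addNode_of_word he h
  exact ⟨g, ⟨h2, mu, h1⟩, h3⟩

lemma exists_isRemovable_of_word {p : ℤ} (h : word e s k0 lam p = -1) :
    ∃ g, IsRemovable e s (k0 : ZMod e) lam g ∧ pos e s k0 g = p := by
  unfold word at h
  rw [beadSign_eq_neg_one] at h
  obtain ⟨g, mu, h1, h2, h3⟩ := exists_addNode_to s h.1 h.2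
  exact ⟨g, ⟨res_eq_of_content h3, mu, h1⟩, pos_eq he h2 h3⟩

lemma ncard_isAddable_between {g h : Node} (hg : res e s g = (k0 : ZMod e))
    (hh : res e s h = (k0 : ZMod e)) :
    {x | IsAddable e s (k0 : ZMod e) lam x ∧ nodeLT s g x ∧ nodeLT s x h}.ncard =
      ((Finset.Ioo (pos e s k0 g) (pos e s k0 h)).filter fun p => word e s k0 lam p = 1).card := by
  rw [← Set.ncard_coe_finset]
  refine Set.ncard_congr (fun x _ => pos e s k0 x) ?_ ?_ ?_
  · rintro x ⟨h1, h2, h3⟩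
    simp only [Finset.coe_filter, Finset.mem_Ioo, Set.mem_ofPred_eq]
    exact ⟨⟨(nodeLT_iff_pos_lt he hg h1.1).1 h2, (nodeLT_iff_pos_lt he h1.1 hh).1 h3⟩,
      h1.word_pos⟩
  · rintro x y ⟨h1, -, -⟩ ⟨h1', -, -⟩ hxy
    exact isAddable_pos_injective h1 h1' hxy
  · intro p hp
    simp only [Finset.coe_filter, Finset.mem_Ioo, Set.mem_ofPred_eq] at hp
    obtain ⟨x, hx, rfl⟩ := exists_isAddable_of_word he hp.2
    exact ⟨x, ⟨hx, (nodeLT_iff_pos_lt he hg hx.1).2 hp.1.1,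
      (nodeLT_iff_pos_lt he hx.1 hh).2 hp.1.2⟩, rfl⟩

lemma ncard_isRemovable_between {g h : Node} (hg : res e s g = (k0 : ZMod e))
    (hh : res e s h = (k0 : ZMod e)) :
    {x | IsRemovable e s (k0 : ZMod e) lam x ∧ nodeLT s g x ∧ nodeLT s x h}.ncard =
      ((Finset.Ioo (pos e s k0 g) (pos e s k0 h)).filter fun p => word e s k0 lam p = -1).card := by
  rw [← Set.ncard_coe_finset]
  refine Set.ncard_congr (fun x _ => pos e s k0 x) ?_ ?_ ?_
  · rintro x ⟨h1, h2, h3⟩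
    simp only [Finset.coe_filter, Finset.mem_Ioo, Set.mem_ofPred_eq]
    exact ⟨⟨(nodeLT_iff_pos_lt he hg h1.1).1 h2, (nodeLT_iff_pos_lt he h1.1 hh).1 h3⟩,
      h1.word_pos⟩
  · rintro x y ⟨h1, -, -⟩ ⟨h1', -, -⟩ hxy
    exact isRemovable_pos_injective h1 h1' hxy
  · intro p hp
    simp only [Finset.coe_filter, Finset.mem_Ioo, Set.mem_ofPred_eq] at hp
    obtain ⟨x, hx, rfl⟩ := exists_isRemovable_of_word he hp.2
    exact ⟨x, ⟨hx, (nodeLT_iff_pos_lt he hg hx.1).2 hp.1.1,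
      (nodeLT_iff_pos_lt he hx.1 hh).2 hp.1.2⟩, rfl⟩

end

/-! ### Normal and good nodes in terms of prefix sums -/

lemma IsPrefix.sum_Ioo {H w : ℤ → ℤ} (hH : IsPrefix H w) {p q : ℤ} (hpq : p < q) :
    ∑ x ∈ Finset.Ioo p q, w x = H (q - 1) - H p := by
  induction q, (show p + 1 ≤ q by omega) using Int.leInduction with
  | base =>
    have : Finset.Ioo p (p + 1) = ∅ := by
      ext x
      simp only [Finset.mem_Ioo, Finset.notMem_empty, iff_false]
      omega
    rw [this]
    simp
  | succ n hn ih =>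
    have e1 : Finset.Ioo p (n + 1) = insert n (Finset.Ioo p n) := by
      ext x
      simp only [Finset.mem_Ioo, Finset.mem_insert]
      omega
    rw [e1, Finset.sum_insert (by simp), ih (by omega), add_sub_cancel_right, ← hH n]
    ring

lemma sum_eq_card_sub_card {w : ℤ → ℤ} (hw : ∀ p, w p = 1 ∨ w p = 0 ∨ w p = -1)
    (S : Finset ℤ) :
    ∑ x ∈ S, w x = (S.filter fun p => w p = 1).card - (S.filter fun p => w p = -1).card := by
  rw [Finset.card_filter, Finset.card_filter]
  push_cast
  rw [← Finset.sum_sub_distrib]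
  refine Finset.sum_congr rfl fun x _ => ?_
  rcases hw x with h | h | h <;> simp [h]

lemma word_cases (e : ℕ) (s : Fin 2 → ℤ) (k0 : ℤ) (lam : Bipartition) (p : ℤ) :
    word e s k0 lam p = 1 ∨ word e s k0 lam p = 0 ∨ word e s k0 lam p = -1 :=
  beadSign_cases _ _ _ _

section
variable {e : ℕ} (he : 1 < e) {s : Fin 2 → ℤ} {k0 : ℤ} {lam mu : Bipartition} {H : ℤ → ℤ}
include he

/-- The sum of the letters strictly between `g` and an addable node `h` is the number of addable
minus the number of removable nodes there, so normality says `H < H (pos g)` just before every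
addable letter after `g`. As `H` rises only at addable letters, and by one, this amounts to `H`
never exceeding `H (pos g)` afterwards. -/
lemma isNormal_iff (hH : IsPrefix H (word e s k0 mu)) {g : Node} :
    IsNormal e s (k0 : ZMod e) mu g ↔ IsRemovable e s (k0 : ZMod e) mu g ∧
      ∀ q, pos e s k0 g ≤ q → H q ≤ H (pos e s k0 g) := by
  unfold IsNormal
  refine and_congr_right fun hg => ?_
  have key : ∀ h, IsAddable e s (k0 : ZMod e) mu h → nodeLT s g h →
      ({x | IsAddable e s (k0 : ZMod e) mu x ∧ nodeLT s g x ∧ nodeLT s x h}.ncard <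
        {x | IsRemovable e s (k0 : ZMod e) mu x ∧ nodeLT s g x ∧ nodeLT s x h}.ncard ↔
      H (pos e s k0 h - 1) < H (pos e s k0 g)) := by
    intro h hh hlt
    have hpos := (nodeLT_iff_pos_lt he hg.1 hh.1).1 hlt
    rw [ncard_isAddable_between he hg.1 hh.1, ncard_isRemovable_between he hg.1 hh.1]
    have h1 := hH.sum_Ioo hpos
    have h2 := sum_eq_card_sub_card (word_cases e s k0 mu)
      (Finset.Ioo (pos e s k0 g) (pos e s k0 h))
    omega
  constructor
  · intro h q hq
    induction q, hq using Int.leInduction with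
    | base => exact le_rfl
    | succ n hn ih =>
      have hn1 := hH (n + 1)
      rw [add_sub_cancel_right] at hn1
      rcases word_cases e s k0 mu (n + 1) with hw | hw | hw
      · obtain ⟨x, hx, hxp⟩ := exists_isAddable_of_word he hw
        have hlt : nodeLT s g x := by
          rw [nodeLT_iff_pos_lt he hg.1 hx.1]
          omega
        have := (key x hx hlt).1 (h x hx hlt)
        rw [hxp, add_sub_cancel_right] at this
        omega
      · omega
      · omega
  · intro h x hx hlt
    rw [key x hx hlt]
    have h1 := (nodeLT_iff_pos_lt he hg.1 hx.1).1 hlt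
    have h2 := h _ h1.le
    have h3 := hH (pos e s k0 x)
    rw [hx.word_pos] at h3
    omega

/-- Here `H (p - 1) = H p + 1` at the position `p` of `g`. The second condition says that `H` never
exceeded this value earlier, and an earlier normal node exists exactly when it did. -/
lemma isGood_iff (hH : IsPrefix H (word e s k0 mu)) {g : Node}
    (hg : IsRemovable e s (k0 : ZMod e) mu g) :
    IsGood e s (k0 : ZMod e) mu g ↔
      (∀ q, pos e s k0 g ≤ q → H q ≤ H (pos e s k0 g)) ∧
      ∀ q < pos e s k0 g, H q ≤ H (pos e s k0 g) + 1 := by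
  unfold IsGood
  rw [isNormal_iff he hH]
  have hgw := hg.word_pos
  set p := pos e s k0 g with hp
  have hHp := hH p
  constructor
  · rintro ⟨⟨-, h1⟩, h2⟩
    refine ⟨h1, ?_⟩
    by_contra! hcon
    obtain ⟨q0, hq0, hHq0⟩ := hcon
    -- At the last earlier point where `H` is too high, the next letter must be removable, and its
    -- node is a normal one below `g`.
    obtain ⟨q, ⟨hq, hHq⟩, hmax⟩ := Int.exists_greatest_of_bdd
      (P := fun q => q < p ∧ H p + 1 < H q) ⟨p, fun z hz => hz.1.le⟩ ⟨q0, hq0, hHq0⟩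
    have hq1 : q + 1 < p := by
      rcases lt_or_ge (q + 1) p with h | h
      · exact h
      · have : q = p - 1 := by omega
        subst this
        omega
    have hq2 : ¬ (q + 1 < p ∧ H p + 1 < H (q + 1)) := fun h => by
      have := hmax _ h
      omega
    have hstep := hH (q + 1)
    rw [add_sub_cancel_right] at hstep
    have hw : word e s k0 mu (q + 1) = -1 := by
      have := word_cases e s k0 mu (q + 1)
      omega
    obtain ⟨x, hx, hxp⟩ := exists_isRemovable_of_word he hw
    refine h2 x ?_ ?_
    · rw [isNormal_iff he hH, hxp]
      refine ⟨hx, fun r hr => ?_⟩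
      rcases lt_or_ge r p with hrp | hrp
      · have : ¬ (r < p ∧ H p + 1 < H r) := fun h => by
          have := hmax _ h
          omega
        omega
      · have := h1 r hrp
        omega
    · rw [nodeLT_iff_pos_lt he hx.1 hg.1, hxp]
      exact hq1
  · rintro ⟨h1, h2⟩
    refine ⟨⟨hg, h1⟩, fun x hx hlt => ?_⟩
    obtain ⟨hx1, hx2⟩ := (isNormal_iff he hH).1 hx
    rw [nodeLT_iff_pos_lt he hx1.1 hg.1] at hlt
    have e1 := hx2 (p - 1) (by omega)
    have e2 := h2 (pos e s k0 x - 1) (by omega)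
    have e3 := hH (pos e s k0 x)
    rw [hx1.word_pos] at e3
    omega

lemma word_addNode {g : Node} (h : AddNode lam g mu) (hg : res e s g = (k0 : ZMod e)) (p : ℤ) :
    word e s k0 mu p = word e s k0 lam p - 2 * ind (p = pos e s k0 g) := by
  by_cases hp : p = pos e s k0 g
  · rw [ind_of hp, hp, IsAddable.word_pos ⟨hg, mu, h⟩, IsRemovable.word_pos ⟨hg, lam, h⟩]
    norm_num
  · rw [ind_of_not hp]
    unfold word beadSign
    have key : ∀ k, (k = posContent e k0 p ∨ k = posContent e k0 p - 1) →
        (k ∈ bead s mu (posComp p) ↔ k ∈ bead s lam (posComp p)) := by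
      intro k hk
      rw [h.mem_bead_iff]
      have hc := posComp_pos (e := e) (s := s) (k0 := k0) g
      have hk' := posContent_pos hg
      have hne : posComp p = g.comp → ¬ (k = content s g) ∧ ¬ (k = content s g - 1) := by
        intro hcomp
        have hp2 : p / 2 ≠ pos e s k0 g / 2 := by
          rw [← hc] at hcomp
          unfold posComp at hcomp
          split_ifs at hcomp <;> simp at hcomp <;> omega
        rw [← hk']
        unfold posContent at *
        -- Here `1 < e` matters: distinct blocks have contents at distance at least 2, so moving a
        -- bead from `k - 1` to `k` cannot touch the two beads read by a letter of another block.
        have : 1 < |(p / 2 - pos e s k0 g / 2) * (e : ℤ)| := by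
          rw [abs_mul, Nat.abs_cast]
          have : 1 ≤ |p / 2 - pos e s k0 g / 2| := Int.one_le_abs (sub_ne_zero.2 hp2)
          nlinarith
        rw [sub_mul, lt_abs] at this
        omega
      constructor
      · rintro (⟨h1, h2⟩ | h1)
        · exact absurd h2 (hne h1).1
        · exact h1.1
      · intro h1
        exact Or.inr ⟨h1, fun h2 => (hne h2.1).2 h2.2⟩
    rw [ind_congr (key _ (Or.inr rfl)), ind_congr (key _ (Or.inl rfl))]
    ring

/-- Adding `g` turns its letter `1` into `-1`, so the prefix sums drop by 2 from `p` on. In terms of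
the old prefix sums, the criterion `isGood_iff` becomes that of a first maximum. -/
lemma isGood_addNode_iff (hH : IsPrefix H (word e s k0 lam)) {g : Node} (h : AddNode lam g mu)
    (hg : res e s g = (k0 : ZMod e)) :
    IsGood e s (k0 : ZMod e) mu g ↔ FirstMax H (pos e s k0 g) := by
  set p := pos e s k0 g with hp
  have hH' : IsPrefix (fun x => H x - 2 * ind (p ≤ x)) (word e s k0 mu) := by
    intro x
    rw [word_addNode he h hg, ← hH x, ← hp]
    change H x - 2 * ind (p ≤ x) - (H (x - 1) - 2 * ind (p ≤ x - 1)) = _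
    unfold ind
    split_ifs <;> omega
  rw [isGood_iff he hH' ⟨hg, lam, h⟩, ← hp, FirstMax, and_comm]
  refine and_congr ?_ ?_
  · refine forall₂_congr fun x hx => ?_
    unfold ind
    split_ifs <;> omega
  · refine forall₂_congr fun x hx => ?_
    unfold ind
    split_ifs <;> omega

lemma arrow_iff (hH : IsPrefix H (word e s k0 lam)) :
    Arrow e s (k0 : ZMod e) lam mu ↔
      ∃ g, AddNode lam g mu ∧ res e s g = (k0 : ZMod e) ∧ FirstMax H (pos e s k0 g) := by
  unfold Arrow
  refine exists_congr fun g => and_congr_right fun h => ?_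
  constructor
  · intro hg
    exact ⟨hg.1.1.1, (isGood_addNode_iff he hH h hg.1.1.1).1 hg⟩
  · rintro ⟨h1, h2⟩
    exact (isGood_addNode_iff he hH h h1).2 h2

lemma Arrow.target_unique {i : ZMod e} {mu mu' : Bipartition} (h : Arrow e s i lam mu)
    (h' : Arrow e s i lam mu') : mu = mu' := by
  obtain ⟨k0, rfl⟩ := ZMod.intCast_surjective i
  obtain ⟨H, hH⟩ := exists_isPrefix (word e s k0 lam)
  obtain ⟨g, h1, h2, h3⟩ := (arrow_iff he hH).1 h
  obtain ⟨g', h1', h2', h3'⟩ := (arrow_iff he hH).1 h'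
  have := isAddable_pos_injective ⟨h2, mu, h1⟩ ⟨h2', mu', h1'⟩ (h3.unique h3')
  subst this
  exact h1.target_unique h1'

end

/-! ### The exchange of pairs on Maya diagrams -/

/-- `D` is the height function of the pair `A`: the number of elements of `A 1` up to `k`
minus the number of elements of `A 0` up to `k`.  It is required to be nonnegative. -/
structure IsHeight (A : Fin 2 → Set ℤ) (D : ℤ → ℤ) : Prop where
  step : ∀ k, D k - D (k - 1) = ind (k ∈ A 1) - ind (k ∈ A 0)
  nonneg : ∀ k, 0 ≤ D k
  zero : ∃ a, ∀ k < a, D k = 0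

/-- `E` is obtained from `A` by exchanging the two entries of every pair of the
Leclerc-Miyachi matching: an element `y` of `A 1` is matched if and only if the height
function returns to the value it had before `y`. -/
structure Swaps (A E : Fin 2 → Set ℤ) (D : ℤ → ℤ) : Prop extends IsHeight A D where
  mem_zero : ∀ y, y ∈ E 0 ↔ y ∈ A 1 ∧ ∃ N, y ≤ N ∧ D N ≤ D (y - 1)
  add_eq : ∀ y, ind (y ∈ E 0) + ind (y ∈ E 1) = ind (y ∈ A 0) + ind (y ∈ A 1)

lemma IsHeight.exists_min {A : Fin 2 → Set ℤ} {D : ℤ → ℤ} (h : IsHeight A D) (k : ℤ) :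
    ∃ m, (∀ N, k ≤ N → m ≤ D N) ∧ ∃ N, k ≤ N ∧ D N = m := by
  obtain ⟨m, ⟨N, hN, hm⟩, hmin⟩ := Int.exists_least_of_bdd
    (P := fun m => ∃ N, k ≤ N ∧ D N = m) ⟨0, by rintro z ⟨N, -, rfl⟩; exact h.nonneg N⟩
    ⟨D k, k, le_rfl, rfl⟩
  exact ⟨m, fun N' hN' => hmin _ ⟨N', hN', rfl⟩, N, hN, hm⟩

/-- The configuration on the left is an opening bracket at `k - 1` closed at once at `k`, that is, a
pair of adjacent entries, and the exchange reverses it. -/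
lemma Swaps.addRem_iff {A E : Fin 2 → Set ℤ} {D : ℤ → ℤ} (h : Swaps A E D) (k : ℤ) :
    ((k - 1 ∈ A 1 ∧ k ∉ A 1) ∧ (k ∈ A 0 ∧ k - 1 ∉ A 0)) ↔
      ((k - 1 ∈ E 0 ∧ k ∉ E 0) ∧ (k ∈ E 1 ∧ k - 1 ∉ E 1)) := by
  have d1 := h.step k
  have d2 := h.step (k - 1)
  have a1 := h.add_eq k
  have a2 := h.add_eq (k - 1)
  constructor
  · rintro ⟨⟨h1, h2⟩, h3, h4⟩
    rw [ind_of_not h2, ind_of h3] at d1 a1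
    rw [ind_of h1, ind_of_not h4] at d2 a2
    have e0 : k - 1 ∈ E 0 := (h.mem_zero _).2 ⟨h1, k, by omega, by omega⟩
    have e1 : k ∉ E 0 := fun hk => h2 ((h.mem_zero _).1 hk).1
    rw [ind_of e0] at a2
    rw [ind_of_not e1] at a1
    refine ⟨⟨e0, e1⟩, ?_, ?_⟩
    · by_contra hk
      rw [ind_of_not hk] at a1
      omega
    · intro hk
      rw [ind_of hk] at a2
      omega
  · rintro ⟨⟨h1, h2⟩, h3, h4⟩
    obtain ⟨hA, N, hN, hDN⟩ := (h.mem_zero _).1 h1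
    rw [ind_of_not h2, ind_of h3] at a1
    rw [ind_of h1, ind_of_not h4, ind_of hA] at a2
    rw [ind_of hA] at d2
    have hA0 : k - 1 ∉ A 0 := by
      intro hk
      rw [ind_of hk] at a2
      omega
    rw [ind_of_not hA0] at d2
    -- The bracket opened at `k - 1` closes later, so one opened at `k` would close as well, putting
    -- `k` into `E 0`.
    have hk1 : k ∉ A 1 := by
      intro hk
      refine h2 ((h.mem_zero _).2 ⟨hk, N, ?_, by omega⟩)
      rcases eq_or_lt_of_le hN with rfl | h'
      · omega
      · omega
    rw [ind_of_not hk1] at a1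
    refine ⟨⟨hA, hk1⟩, ?_, hA0⟩
    by_contra hk
    rw [ind_of_not hk] at a1
    omega

/-- The values at `k - 1` and `k` in `Swaps.move`. -/
lemma move_local {p0 q0 p1 q1 r0 t0 r1 t1 p0' q0' p1' q1' r0' t0' r1' t1' : Prop}
    {a b d m δ : ℤ}
    (d1 : d - b = ind q1 - ind q0) (d2 : b - a = ind p1 - ind p0)
    (a1 : ind t0 + ind t1 = ind q0 + ind q1) (a2 : ind r0 + ind r1 = ind p0 + ind p1)
    (z1 : t0 ↔ q1 ∧ m ≤ b) (z2 : r0 ↔ p1 ∧ (b ≤ a ∨ m ≤ a)) (hm : m ≤ d)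
    (hA : (δ = -1 ∧ p1 ∧ ¬ q1 ∧ ¬ (p0 ∧ ¬ q0) ∧ ¬ p1' ∧ q1' ∧ (p0' ↔ p0) ∧ (q0' ↔ q0)) ∨
      (δ = 1 ∧ p0 ∧ ¬ q0 ∧ ¬ (q1 ∧ ¬ p1) ∧ ¬ p0' ∧ q0' ∧ (p1' ↔ p1) ∧ (q1' ↔ q1)))
    (hE : (r0 ∧ ¬ t0 ∧ ¬ (r1 ∧ ¬ t1) ∧ ¬ r0' ∧ t0' ∧ (r1' ↔ r1) ∧ (t1' ↔ t1)) ∨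
      (r1 ∧ ¬ t1 ∧ ¬ (t0 ∧ ¬ r0) ∧ ¬ r1' ∧ t1' ∧ (r0' ↔ r0) ∧ (t0' ↔ t0))) :
    ((a ≤ b + δ ∨ d ≤ b + δ) ∧ (a ≤ b ∨ d ≤ b)) ∧
    (d - (b + δ) = ind q1' - ind q0' ∧ b + δ - a = ind p1' - ind p0') ∧
    ((t0' ↔ q1' ∧ m ≤ b + δ) ∧ (r0' ↔ p1' ∧ (b + δ ≤ a ∨ m ≤ a))) ∧
    (ind t0' + ind t1' = ind q0' + ind q1' ∧ ind r0' + ind r1' = ind p0' + ind p1') := by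
  rcases hA with hA | hA <;> rcases hE with hE | hE <;> grind [ind]

/-- Moving a bead from `k - 1` to `k` in `A` and in `E`, where in `A` the component `1` comes
first and in `E` the component `0` comes first, is compatible with the exchange of pairs. -/
lemma Swaps.move {A E A' E' : Fin 2 → Set ℤ} {D : ℤ → ℤ} (h : Swaps A E D) (k : ℤ)
    (c c' : Fin 2)
    (hA : ∀ d x, x ∈ A' d ↔ (d = c ∧ x = k) ∨ (x ∈ A d ∧ ¬ (d = c ∧ x = k - 1)))
    (hE : ∀ d x, x ∈ E' d ↔ (d = c' ∧ x = k) ∨ (x ∈ E d ∧ ¬ (d = c' ∧ x = k - 1)))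
    (hc : k - 1 ∈ A c ∧ k ∉ A c) (hc' : k - 1 ∈ E c' ∧ k ∉ E c')
    (hA1 : c = 1 → ¬ (k - 1 ∈ A 0 ∧ k ∉ A 0)) (hA0 : c = 0 → ¬ (k ∈ A 1 ∧ k - 1 ∉ A 1))
    (hE0 : c' = 0 → ¬ (k - 1 ∈ E 1 ∧ k ∉ E 1)) (hE1 : c' = 1 → ¬ (k ∈ E 0 ∧ k - 1 ∉ E 0)) :
    ∃ D', Swaps A' E' D' := by
  -- The minimum `m` of `D` on `[k, ∞)` is all that the matching of `k - 1` and `k` needs to know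
  -- about what lies to the right.
  obtain ⟨m, hm, N0, hN0, hmN⟩ := h.exists_min k
  have d1 := h.step k
  have d2 := h.step (k - 1)
  have a1 := h.add_eq k
  have a2 := h.add_eq (k - 1)
  have z1 := h.mem_zero k
  have z2 := h.mem_zero (k - 1)
  have n1 := h.nonneg k
  have n2 := h.nonneg (k - 1)
  have n3 := h.nonneg (k - 1 - 1)
  have hmk := hm k le_rfl
  have w1 : (∃ N, k ≤ N ∧ D N ≤ D (k - 1)) ↔ m ≤ D (k - 1) :=
    ⟨fun ⟨N, hN, hD⟩ => (hm N hN).trans hD, fun hle => ⟨N0, hN0, by omega⟩⟩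
  have w2 : (∃ N, k - 1 ≤ N ∧ D N ≤ D (k - 1 - 1)) ↔
      D (k - 1) ≤ D (k - 1 - 1) ∨ m ≤ D (k - 1 - 1) := by
    constructor
    · rintro ⟨N, hN, hD⟩
      rcases eq_or_lt_of_le hN with rfl | h'
      · exact Or.inl hD
      · exact Or.inr ((hm N (by omega)).trans hD)
    · rintro (h' | h')
      · exact ⟨k - 1, le_rfl, h'⟩
      · exact ⟨N0, by omega, by omega⟩
  rw [w1] at z1
  rw [w2] at z2
  -- Delaying a bead from `k - 1` to `k` changes the height at `k - 1` only: down for an opening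
  -- bracket, up for a closing one.
  let δ : ℤ := if c = 1 then -1 else 1
  let D' : ℤ → ℤ := fun x => if x = k - 1 then D x + δ else D x
  have hD'k : D' (k - 1) = D (k - 1) + δ := if_pos rfl
  have hD'ne : ∀ x, x ≠ k - 1 → D' x = D x := fun x hx => if_neg hx
  have hmem : ∀ d x, x ≠ k → x ≠ k - 1 → (x ∈ A' d ↔ x ∈ A d) := by
    intro d x h1 h2
    rw [hA]
    simp [h1, h2]
  have hmem' : ∀ d x, x ≠ k → x ≠ k - 1 → (x ∈ E' d ↔ x ∈ E d) := by
    intro d x h1 h2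
    rw [hE]
    simp [h1, h2]
  have cases2 : ∀ d : Fin 2, d = 0 ∨ d = 1 := by decide
  have hne : k - 1 ≠ k := by omega
  have hA' : ∀ d, (k ∈ A' d ↔ d = c ∨ k ∈ A d) ∧ (k - 1 ∈ A' d ↔ k - 1 ∈ A d ∧ d ≠ c) := by
    intro d
    rw [hA, hA]
    simp [hne, hne.symm]
  have hE' : ∀ d, (k ∈ E' d ↔ d = c' ∨ k ∈ E d) ∧ (k - 1 ∈ E' d ↔ k - 1 ∈ E d ∧ d ≠ c') := by
    intro d
    rw [hE, hE]
    simp [hne, hne.symm]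
  obtain ⟨bounds, pk, mk, sk⟩ := move_local (δ := δ)
    (p0' := k - 1 ∈ A' 0) (q0' := k ∈ A' 0) (p1' := k - 1 ∈ A' 1) (q1' := k ∈ A' 1)
    (r0' := k - 1 ∈ E' 0) (t0' := k ∈ E' 0) (r1' := k - 1 ∈ E' 1) (t1' := k ∈ E' 1)
    d1 d2 a1 a2 z1 z2 hmk
    (by
      rw [(hA' 0).1, (hA' 0).2, (hA' 1).1, (hA' 1).2]
      rcases cases2 c with rfl | rfl
      · exact Or.inr ⟨rfl, hc.1, hc.2, hA0 rfl, by simp, by simp, by simp, by simp⟩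
      · exact Or.inl ⟨rfl, hc.1, hc.2, hA1 rfl, by simp, by simp, by simp, by simp⟩)
    (by
      rw [(hE' 0).1, (hE' 0).2, (hE' 1).1, (hE' 1).2]
      rcases cases2 c' with rfl | rfl
      · exact Or.inl ⟨hc'.1, hc'.2, hE0 rfl, by simp, by simp, by simp, by simp⟩
      · exact Or.inr ⟨hc'.1, hc'.2, hE1 rfl, by simp, by simp, by simp, by simp⟩)
  -- By `bounds`, the height at `k - 1` is at least one of its neighbours, both before and after the
  -- move. So it stays nonnegative, and a return at `N = k - 1` can be replaced by one at `k - 2` or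
  -- `k` when testing the other beads.
  have hnn : 0 ≤ D (k - 1) + δ := by omega
  rw [← hD'k, ← hD'ne k (by omega), ← hD'ne (k - 1 - 1) (by omega)] at pk
  refine ⟨D', ⟨⟨fun x => ?_, fun x => ?_, ?_⟩, fun y => ?_, fun y => ?_⟩⟩
  · by_cases h1 : x = k
    · subst h1
      exact pk.1
    by_cases h2 : x = k - 1
    · subst h2
      exact pk.2
    rw [hD'ne x h2, hD'ne (x - 1) (by omega), h.step, ind_congr (hmem 0 x h1 h2),
      ind_congr (hmem 1 x h1 h2)]
  · by_cases h2 : x = k - 1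
    · subst h2
      rw [hD'k]
      exact hnn
    · rw [hD'ne x h2]
      exact h.nonneg x
  · obtain ⟨a, ha⟩ := h.zero
    refine ⟨min a (k - 1), fun x hx => ?_⟩
    rw [lt_min_iff] at hx
    rw [hD'ne x hx.2.ne]
    exact ha x hx.1
  · by_cases h1 : y = k
    · subst h1
      rw [mk.1, hD'k]
      refine and_congr_right fun _ => ⟨fun hle => ⟨N0, hN0, ?_⟩, ?_⟩
      · rw [hD'ne N0 (by omega)]
        omega
      · rintro ⟨N, hN, hD⟩
        rw [hD'ne N (by omega)] at hD
        exact (hm N hN).trans hD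
    by_cases h2 : y = k - 1
    · subst h2
      rw [mk.2, hD'ne (k - 1 - 1) (by omega)]
      refine and_congr_right fun _ => ⟨?_, ?_⟩
      · rintro (hle | hle)
        · exact ⟨k - 1, le_rfl, by rw [hD'k]; exact hle⟩
        · exact ⟨N0, by omega, by rw [hD'ne N0 (by omega)]; omega⟩
      · rintro ⟨N, hN, hD⟩
        by_cases hNk : N = k - 1
        · subst hNk
          rw [hD'k] at hD
          exact Or.inl hD
        · rw [hD'ne N hNk] at hD
          exact Or.inr ((hm N (by omega)).trans hD)
    rw [hmem' 0 y h1 h2, hmem 1 y h1 h2, h.mem_zero, hD'ne (y - 1) (by omega)]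
    refine and_congr_right fun _ => ⟨?_, ?_⟩
    · rintro ⟨N, hN, hD⟩
      by_cases hNk : N = k - 1
      · subst hNk
        rcases bounds.2 with hb | hb
        · exact ⟨k - 1 - 1, by omega, by rw [hD'ne _ (by omega)]; omega⟩
        · exact ⟨k, by omega, by rw [hD'ne _ (by omega)]; omega⟩
      · exact ⟨N, hN, by rw [hD'ne _ hNk]; exact hD⟩
    · rintro ⟨N, hN, hD⟩
      by_cases hNk : N = k - 1
      · subst hNk
        rw [hD'k] at hD
        rcases bounds.1 with hb | hb
        · exact ⟨k - 1 - 1, by omega, by omega⟩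
        · exact ⟨k, by omega, by omega⟩
      · exact ⟨N, hN, by rwa [hD'ne _ hNk] at hD⟩
  · by_cases h1 : y = k
    · subst h1
      exact sk.1
    by_cases h2 : y = k - 1
    · subst h2
      exact sk.2
    rw [ind_congr (hmem' 0 y h1 h2), ind_congr (hmem' 1 y h1 h2), h.add_eq,
      ind_congr (hmem 0 y h1 h2), ind_congr (hmem 1 y h1 h2)]

/-! ### Uniqueness of the exchange in both directions -/

lemma ind_inj {P Q : Prop} (h : ind P = ind Q) : P ↔ Q := by
  unfold ind at h
  split_ifs at h <;> simp_all

lemma ind_cases (P : Prop) : ind P = 0 ∨ ind P = 1 := by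
  unfold ind
  split_ifs <;> simp

lemma IsHeight.unique {A : Fin 2 → Set ℤ} {D D' : ℤ → ℤ} (h : IsHeight A D)
    (h' : IsHeight A D') : D = D' := by
  obtain ⟨a, ha⟩ := h.zero
  obtain ⟨a', ha'⟩ := h'.zero
  funext k
  have key : ∀ k, min a a' - 1 ≤ k → D k = D' k := by
    intro k hk
    induction k, hk using Int.leInduction with
    | base => rw [ha _ (by omega), ha' _ (by omega)]
    | succ n hn ih =>
      have e1 := h.step (n + 1)
      have e2 := h'.step (n + 1)
      rw [add_sub_cancel_right] at e1 e2
      omega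
  rcases le_total (min a a' - 1) k with hk | hk
  · exact key k hk
  · rw [ha _ (by omega), ha' _ (by omega)]

lemma Swaps.right_unique {A E E' : Fin 2 → Set ℤ} {D D' : ℤ → ℤ} (h : Swaps A E D)
    (h' : Swaps A E' D') (c : Fin 2) (y : ℤ) : y ∈ E c ↔ y ∈ E' c := by
  obtain rfl := h.toIsHeight.unique h'.toIsHeight
  have h0 : y ∈ E 0 ↔ y ∈ E' 0 := by rw [h.mem_zero, h'.mem_zero]
  have h1 : y ∈ E 1 ↔ y ∈ E' 1 := by
    apply ind_inj
    have e1 := h.add_eq y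
    have e2 := h'.add_eq y
    rw [ind_congr h0] at e1
    omega
  fin_cases c
  · exact h0
  · exact h1

/-- The future minimum `I` of the height function `D`; then `2 * I - D` is the height function
of the pair obtained by the exchange. -/
lemma Swaps.exists_future_min {A E : Fin 2 → Set ℤ} {D : ℤ → ℤ} (h : Swaps A E D) :
    ∃ I : ℤ → ℤ, (∀ k, I k ≤ D k) ∧ (∀ k, I (k - 1) = min (D (k - 1)) (I k)) ∧
      (∃ a, ∀ k < a, I k = 0) ∧ (∀ k, I k - I (k - 1) = ind (k ∈ A 1) - ind (k ∈ E 0)) := by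
  choose I hI N hN hDN using h.toIsHeight.exists_min
  have hmin : ∀ k, I (k - 1) = min (D (k - 1)) (I k) := by
    intro k
    apply le_antisymm
    · refine le_min (hI _ _ le_rfl) ?_
      rw [← hDN k]
      exact hI _ _ (by have := hN k; omega)
    · rw [← hDN (k - 1)]
      rcases eq_or_lt_of_le (hN (k - 1)) with h1 | h1
      · rw [← h1]
        exact min_le_left _ _
      · exact (min_le_right _ _).trans (hI _ _ (by omega))
  refine ⟨I, fun k => hI k k le_rfl, hmin, ?_, fun k => ?_⟩
  · obtain ⟨a, ha⟩ := h.zero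
    refine ⟨a, fun k hk => le_antisymm ?_ ?_⟩
    · rw [← ha k hk]
      exact hI k k le_rfl
    · rw [← hDN]
      exact h.nonneg _
  · have h1 := h.step k
    have h2 := hmin k
    have h3 := hI k k le_rfl
    have h4 := h.mem_zero k
    have h5 : (∃ N, k ≤ N ∧ D N ≤ D (k - 1)) ↔ I k ≤ D (k - 1) :=
      ⟨fun ⟨M, hM, hD⟩ => (hI k M hM).trans hD, fun hle => ⟨N k, hN k, by rw [hDN]; exact hle⟩⟩
    rw [h5] at h4
    grind [ind]

/-- Recover `D` and its future minimum `I` together, from left to right. If `I < D` at `n`, then `I`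
is constant on the next step, so `A 1` and `A 0` at `n + 1` are read off `E 0` and `E 1`. If `I =
D`, then `I` cannot decrease and cannot pass `D`, so a single bead at `n + 1` must belong to `A 1`.
-/
lemma Swaps.left_unique {A A' E : Fin 2 → Set ℤ} {D D' : ℤ → ℤ} (h : Swaps A E D)
    (h' : Swaps A' E D') (c : Fin 2) (y : ℤ) : y ∈ A c ↔ y ∈ A' c := by
  obtain ⟨I, hle, hmin, ⟨a, ha⟩, hstep⟩ := h.exists_future_min
  obtain ⟨I', hle', hmin', ⟨a', ha'⟩, hstep'⟩ := h'.exists_future_min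
  obtain ⟨b, hb⟩ := h.zero
  obtain ⟨b', hb'⟩ := h'.zero
  have key : ∀ k, min (min a a') (min b b') - 1 ≤ k → I k = I' k ∧ D k = D' k := by
    intro k hk
    induction k, hk using Int.leInduction with
    | base =>
      rw [ha _ (by omega), ha' _ (by omega), hb _ (by omega), hb' _ (by omega)]
      exact ⟨rfl, rfl⟩
    | succ n hn ih =>
      have e1 := h.step (n + 1)
      have e2 := h'.step (n + 1)
      have e3 := hstep (n + 1)
      have e4 := hstep' (n + 1)
      have e5 := hmin (n + 1)
      have e6 := hmin' (n + 1)
      have e7 := h.add_eq (n + 1)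
      have e8 := h'.add_eq (n + 1)
      have e9 := hle (n + 1)
      have e10 := hle' (n + 1)
      rw [add_sub_cancel_right] at e1 e2 e3 e4 e5 e6
      have i1 := ind_cases (n + 1 ∈ A 0)
      have i2 := ind_cases (n + 1 ∈ A 1)
      have i3 := ind_cases (n + 1 ∈ A' 0)
      have i4 := ind_cases (n + 1 ∈ A' 1)
      have i5 := ind_cases (n + 1 ∈ E 0)
      omega
  have hD : ∀ k, D k = D' k := by
    intro k
    rcases le_total (min (min a a') (min b b') - 1) k with hk | hk
    · exact (key k hk).2
    · rw [hb _ (by omega), hb' _ (by omega)]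
  have e1 := h.step y
  have e2 := h'.step y
  have e3 := h.add_eq y
  have e4 := h'.add_eq y
  rw [hD, hD] at e1
  apply ind_inj
  fin_cases c
  · change ind (y ∈ A 0) = ind (y ∈ A' 0)
    omega
  · change ind (y ∈ A 1) = ind (y ∈ A' 1)
    omega

/-- `mu` is obtained from `lam` by exchanging the entries of the pairs of its symbol. -/
def UpsilonRel (s : Fin 2 → ℤ) (lam mu : Bipartition) : Prop :=
  ∃ D, Swaps (bead s lam) (bead s mu) D

lemma UpsilonRel.right_unique {s : Fin 2 → ℤ} {lam mu mu' : Bipartition}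
    (h : UpsilonRel s lam mu) (h' : UpsilonRel s lam mu') : mu = mu' := by
  obtain ⟨D, h⟩ := h
  obtain ⟨D', h'⟩ := h'
  exact bead_injective s (h.right_unique h')

lemma UpsilonRel.left_unique {s : Fin 2 → ℤ} {lam lam' mu : Bipartition}
    (h : UpsilonRel s lam mu) (h' : UpsilonRel s lam' mu) : lam = lam' := by
  obtain ⟨D, h⟩ := h
  obtain ⟨D', h'⟩ := h'
  exact bead_injective s (h.left_unique h')

lemma upsilonRel_empty {s : Fin 2 → ℤ} (hs : s 0 ≤ s 1) :
    UpsilonRel s emptyBip emptyBip := by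
  -- The beads of component `c` fill `k < s c`, so the height is `0` below `s 0`, climbs by one per
  -- step, and is constant from `s 1 - 1` on; the brackets on `[s 0, s 1)` never close.
  refine ⟨fun k => max 0 (min (k + 1 - s 0) (s 1 - s 0)), ⟨fun k => ?_, fun k => ?_, ?_⟩,
    fun y => ?_, fun y => rfl⟩
  · rw [ind_congr (mem_bead_empty s 0 k), ind_congr (mem_bead_empty s 1 k)]
    unfold ind
    split_ifs <;> omega
  · exact le_max_left _ _
  · exact ⟨s 0, fun k hk => by omega⟩
  · rw [mem_bead_empty, mem_bead_empty]
    constructor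
    · intro hy
      exact ⟨by omega, y, le_rfl, by omega⟩
    · rintro ⟨h1, N, hN, hD⟩
      omega

/-! ### Comparison of signatures -/

/-- Two signatures made of blocks of two letters, with equal block sums and the letters `+ -`
occurring in the same blocks, have their first maxima in the same block. -/
lemma FirstMax.exists_of_blocks {H H' f g f' g' : ℤ → ℤ}
    (hf : ∀ t, H (2 * t) - H (2 * t - 1) = f t) (hg : ∀ t, H (2 * t + 1) - H (2 * t) = g t)
    (hf' : ∀ t, H' (2 * t) - H' (2 * t - 1) = f' t)
    (hg' : ∀ t, H' (2 * t + 1) - H' (2 * t) = g' t)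
    (hf1 : ∀ t, f t = 1 ∨ f t = 0 ∨ f t = -1) (hg1 : ∀ t, g t = 1 ∨ g t = 0 ∨ g t = -1)
    (hf1' : ∀ t, f' t = 1 ∨ f' t = 0 ∨ f' t = -1) (hg1' : ∀ t, g' t = 1 ∨ g' t = 0 ∨ g' t = -1)
    (hsum : ∀ t, f t + g t = f' t + g' t)
    (hiff : ∀ t, (f t = 1 ∧ g t = -1) ↔ (f' t = 1 ∧ g' t = -1)) {p : ℤ} (hp : FirstMax H p) :
    ∃ p', FirstMax H' p' ∧ p' / 2 = p / 2 := by
  -- Equal block sums make `H - H'` constant on block ends, that is, on odd points.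
  obtain ⟨C, hC⟩ : ∃ C, ∀ t, H (2 * t - 1) = H' (2 * t - 1) + C := by
    refine ⟨H (2 * 0 - 1) - H' (2 * 0 - 1), fun t => ?_⟩
    induction t using Int.induction_on with
    | zero => ring
    | succ n ih =>
      have e1 := hf n
      have e2 := hg n
      have e3 := hf' n
      have e4 := hg' n
      have e5 := hsum n
      rw [show 2 * ((n : ℤ) + 1) - 1 = 2 * n + 1 by ring]
      omega
    | pred n ih =>
      have e1 := hf (-n - 1)
      have e2 := hg (-n - 1)
      have e3 := hf' (-n - 1)
      have e4 := hg' (-n - 1)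
      have e5 := hsum (-n - 1)
      rw [show 2 * (-(n : ℤ) - 1) + 1 = 2 * -n - 1 by ring] at e2 e4
      omega
  have hC1 : ∀ t, H (2 * t + 1) = H' (2 * t + 1) + C := by
    intro t
    have := hC (t + 1)
    rwa [show 2 * (t + 1) - 1 = 2 * t + 1 by ring] at this
  obtain ⟨t, ht⟩ : ∃ t, t = p / 2 := ⟨_, rfl⟩
  have F : ∀ x, (x < p → H x < H p) ∧ (p ≤ x → H x ≤ H p) := fun x => ⟨hp.1 x, hp.2 x⟩
  have hpt : p = 2 * t ∨ p = 2 * t + 1 := by omega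
  obtain ⟨p', hp', hpp⟩ : ∃ p', (p' = 2 * t ∧ f' t = 1 ∧ g' t ≤ 0 ∨ p' = 2 * t + 1 ∧ g' t = 1 ∧
      0 ≤ f' t) ∧ H p = H' p' + C := by
    have e1 := hf t
    have e2 := hg t
    have e3 := hf' t
    have e4 := hg' t
    have e5 := hsum t
    have e6 := hiff t
    have e7 := hC t
    have e8 := hC1 t
    have e9 := hf1 t
    have e10 := hg1 t
    have e11 := hf1' t
    have e12 := hg1' t
    have F1 := F (2 * t - 1)
    have F2 := F (2 * t)
    have F3 := F (2 * t + 1)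
    -- The maximum inside the block of `H'` is first attained at its first letter only when that
    -- letter is `+` and the second one does not increase the sum.
    by_cases hcase : f' t = 1 ∧ g' t ≤ 0
    · refine ⟨2 * t, Or.inl ⟨rfl, hcase.1, hcase.2⟩, ?_⟩
      rcases hpt with h | h <;> rw [h] at F1 F2 F3 ⊢ <;> omega
    · refine ⟨2 * t + 1, Or.inr ⟨rfl, ?_, ?_⟩, ?_⟩ <;>
      rcases hpt with h | h <;> rw [h] at F1 F2 F3 <;> try rw [h]
      all_goals omega
  have G : ∀ x, (x < p' → H' x + C < H p) ∧ (p' ≤ x → H' x + C ≤ H p) := by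
    intro x
    obtain ⟨u, hu⟩ : ∃ u, u = x / 2 := ⟨_, rfl⟩
    have e1 := hf u
    have e2 := hg u
    have e3 := hf' u
    have e4 := hg' u
    have e6 := hiff u
    have e7 := hC u
    have e8 := hC1 u
    have e9 := hf1 u
    have e10 := hg1 u
    have e11 := hf1' u
    have e12 := hg1' u
    have e13 := hsum u
    have F1 := F (2 * u - 1)
    have F2 := F (2 * u)
    have F3 := F (2 * u + 1)
    rcases lt_trichotomy u t with hut | hut | hut
    · rcases (show x = 2 * u ∨ x = 2 * u + 1 by omega) with rfl | rfl <;> omega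
    · subst hut
      rcases (show x = 2 * u ∨ x = 2 * u + 1 by omega) with rfl | rfl <;>
      rcases hp' with ⟨rfl, h⟩ | ⟨rfl, h⟩ <;> omega
    · rcases (show x = 2 * u ∨ x = 2 * u + 1 by omega) with rfl | rfl <;> omega
  refine ⟨p', ⟨fun x hx => ?_, fun x hx => ?_⟩, by omega⟩
  · have := (G x).1 hx
    omega
  · have := (G x).2 hx
    omega

/-! ### Correspondences between crystals -/

/-- `R` is a one-to-one correspondence between some vertices of the crystals of charges `s`
and `s'`, compatible with the arrows. -/
structure IsBisim (e : ℕ) (s s' : Fin 2 → ℤ) (R : Bipartition → Bipartition → Prop) : Prop where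
  empty : R emptyBip emptyBip
  forward : ∀ {lam mu lam' i}, R lam mu → Arrow e s i lam lam' →
    ∃ mu', Arrow e s' i mu mu' ∧ R lam' mu'
  backward : ∀ {lam mu mu' i}, R lam mu → Arrow e s' i mu mu' →
    ∃ lam', Arrow e s i lam lam' ∧ R lam' mu'
  right_unique : ∀ {lam mu mu'}, R lam mu → R lam mu' → mu = mu'
  left_unique : ∀ {lam lam' mu}, R lam mu → R lam' mu → lam = lam'

lemma Arrow.rank_eq {e : ℕ} {s : Fin 2 → ℤ} {i : ZMod e} {lam mu : Bipartition}
    (h : Arrow e s i lam mu) : rank mu = rank lam + 1 := by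
  obtain ⟨g, hg, -⟩ := h
  exact hg.rank_eq

section
variable {e : ℕ} (he : 1 < e) {s s' s'' : Fin 2 → ℤ} {R R' : Bipartition → Bipartition → Prop}

lemma IsBisim.flip (h : IsBisim e s s' R) : IsBisim e s' s (fun lam mu => R mu lam) where
  empty := h.empty
  forward := h.backward
  backward := h.forward
  right_unique := h.left_unique
  left_unique := h.right_unique

lemma IsBisim.comp (h : IsBisim e s s' R) (h' : IsBisim e s' s'' R') :
    IsBisim e s s'' (fun lam nu => ∃ mu, R lam mu ∧ R' mu nu) where
  empty := ⟨_, h.empty, h'.empty⟩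
  forward := by
    rintro lam nu lam' i ⟨mu, h1, h2⟩ ha
    obtain ⟨mu', h3, h4⟩ := h.forward h1 ha
    obtain ⟨nu', h5, h6⟩ := h'.forward h2 h3
    exact ⟨nu', h5, mu', h4, h6⟩
  backward := by
    rintro lam nu nu' i ⟨mu, h1, h2⟩ ha
    obtain ⟨mu', h3, h4⟩ := h'.backward h2 ha
    obtain ⟨lam', h5, h6⟩ := h.backward h1 h3
    exact ⟨lam', h5, mu', h6, h4⟩
  right_unique := by
    rintro lam nu nu' ⟨mu, h1, h2⟩ ⟨mu', h3, h4⟩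
    obtain rfl := h.right_unique h1 h3
    exact h'.right_unique h2 h4
  left_unique := by
    rintro lam lam' nu ⟨mu, h1, h2⟩ ⟨mu', h3, h4⟩
    obtain rfl := h'.left_unique h2 h4
    exact h.left_unique h1 h3

lemma IsBisim.exists_of_isUglov (h : IsBisim e s s' R) {lam : Bipartition}
    (hlam : IsUglov e s lam) :
    ∃ mu, R lam mu ∧ IsUglov e s' mu ∧ rank mu = rank lam ∧ CrystalRel e s s' lam mu := by
  induction hlam with
  | empty => exact ⟨emptyBip, h.empty, .empty, rfl, .empty⟩
  | step _ ha ih =>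
    obtain ⟨mu, h1, h2, h3, h4⟩ := ih
    obtain ⟨mu', h5, h6⟩ := h.forward h1 ha
    exact ⟨mu', h6, h2.step h5, by rw [h5.rank_eq, ha.rank_eq, h3], h4.step ha h5⟩

include he in
-- Targets of arrows of a given colour are unique, so the recursive rule can only follow `R`; this
-- gives the functionality of the rule.
lemma IsBisim.rel_of_crystalRel (h : IsBisim e s s' R) {lam mu : Bipartition}
    (hr : CrystalRel e s s' lam mu) : R lam mu := by
  induction hr with
  | empty => exact h.empty
  | step _ ha ha' ih =>
    obtain ⟨mu', h1, h2⟩ := h.forward ih ha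
    rwa [← h1.target_unique he ha']

lemma IsBisim.exists_uglovSet (h : IsBisim e s s' R) {n : ℕ} (lam : UglovSet e n s) :
    ∃ mu : UglovSet e n s', R lam mu ∧ CrystalRel e s s' lam mu := by
  obtain ⟨mu, h1, h2, h3, h4⟩ := h.exists_of_isUglov lam.2.1
  exact ⟨⟨mu, h2, h3.trans lam.2.2⟩, h1, h4⟩

/-- The bijection between Uglov bipartitions defined by a correspondence of crystals. -/
noncomputable def IsBisim.equiv (h : IsBisim e s s' R) (n : ℕ) :
    UglovSet e n s ≃ UglovSet e n s' where
  toFun lam := (h.exists_uglovSet lam).choose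
  invFun mu := (h.flip.exists_uglovSet mu).choose
  left_inv lam := Subtype.ext <| h.left_unique
    (h.flip.exists_uglovSet (h.exists_uglovSet lam).choose).choose_spec.1
    (h.exists_uglovSet lam).choose_spec.1
  right_inv mu := Subtype.ext <| h.right_unique
    (h.exists_uglovSet (h.flip.exists_uglovSet mu).choose).choose_spec.1
    (h.flip.exists_uglovSet mu).choose_spec.1

lemma IsBisim.rel_equiv (h : IsBisim e s s' R) (n : ℕ) (lam : UglovSet e n s) :
    R lam (h.equiv n lam) :=
  (h.exists_uglovSet lam).choose_spec.1

include he in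
lemma IsBisim.isCrystalBijection (h : IsBisim e s s' R) (n : ℕ) :
    IsCrystalBijection e n s s' (h.equiv n) := by
  intro lam mu
  constructor
  · intro hr
    exact h.right_unique (h.rel_equiv n lam) (h.rel_of_crystalRel he hr)
  · rintro rfl
    exact (h.exists_uglovSet lam).choose_spec.2

end

/-! ### The correspondence given by the exchange of pairs -/

section
variable {e : ℕ} (he : 1 < e) {s s' : Fin 2 → ℤ} {k0 : ℤ}

lemma word_even (lam : Bipartition) (t : ℤ) :
    word e s k0 lam (2 * t) = beadSign s lam 1 (k0 + t * e) := by
  unfold word posComp posContent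
  rw [if_pos (by omega), show 2 * t / 2 = t by omega]

lemma word_odd (lam : Bipartition) (t : ℤ) :
    word e s k0 lam (2 * t + 1) = beadSign s lam 0 (k0 + t * e) := by
  unfold word posComp posContent
  rw [if_neg (by omega), show (2 * t + 1) / 2 = t by omega]

lemma beadSign_zero_of_charge (h0 : s' 0 = s 0) (lam : Bipartition) (k : ℤ) :
    beadSign s' lam 0 k = beadSign s lam 0 k := by
  simp only [beadSign, bead, h0]

lemma beadSign_one_of_charge (h1 : s' 1 = s 1 + e) (lam : Bipartition) (k : ℤ) :
    beadSign s' lam 1 (k + e) = beadSign s lam 1 k := by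
  unfold beadSign
  congr 1
  · refine ind_congr ?_
    change k + e - 1 - s' 1 ∈ maya (lam 1) ↔ k - 1 - s 1 ∈ maya (lam 1)
    rw [h1, show k + e - 1 - (s 1 + e) = k - 1 - s 1 by ring]
  · refine ind_congr ?_
    change k + e - s' 1 ∈ maya (lam 1) ↔ k - s 1 ∈ maya (lam 1)
    rw [h1, show k + e - (s 1 + e) = k - s 1 by ring]

lemma posContent_even (t : ℤ) : posContent e k0 (2 * t) = k0 + t * e := by
  unfold posContent
  rw [show 2 * t / 2 = t by omega]

lemma posContent_odd (t : ℤ) : posContent e k0 (2 * t + 1) = k0 + t * e := by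
  unfold posContent
  rw [show (2 * t + 1) / 2 = t by omega]

lemma posComp_even (t : ℤ) : posComp (2 * t) = 1 := if_pos (by omega)

lemma posComp_odd (t : ℤ) : posComp (2 * t + 1) = 0 := if_neg (by omega)

lemma Swaps.beadSign_add_eq {lam mu : Bipartition} {D : ℤ → ℤ}
    (h : Swaps (bead s lam) (bead s mu) D) (k : ℤ) :
    beadSign s lam 1 k + beadSign s lam 0 k = beadSign s mu 0 k + beadSign s mu 1 k := by
  have e1 := h.add_eq k
  have e2 := h.add_eq (k - 1)
  unfold beadSign
  omega

lemma Swaps.beadSign_iff {lam mu : Bipartition} {D : ℤ → ℤ}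
    (h : Swaps (bead s lam) (bead s mu) D) (k : ℤ) :
    (beadSign s lam 1 k = 1 ∧ beadSign s lam 0 k = -1) ↔
      (beadSign s mu 0 k = 1 ∧ beadSign s mu 1 k = -1) := by
  rw [beadSign_eq_one, beadSign_eq_one, beadSign_eq_neg_one, beadSign_eq_neg_one]
  exact h.addRem_iff k

/-- At the first maximum of a signature made of blocks `w (2 * t)`, `w (2 * t + 1)`, the other
letter of the block does not compete. -/
lemma FirstMax.even {H w : ℤ → ℤ} (hH : IsPrefix H w) {t : ℤ} (h : FirstMax H (2 * t)) :
    0 < w (2 * t) ∧ w (2 * t + 1) ≤ 0 := by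
  have e1 := hH (2 * t)
  have e2 := hH (2 * t + 1)
  have e3 := h.1 (2 * t - 1) (by omega)
  have e4 := h.2 (2 * t + 1) (by omega)
  rw [add_sub_cancel_right] at e2
  omega

/-- Comparison with the preceding block end gives the second inequality: as letters are at most 1,
the first letter of the block is not removable. -/
lemma FirstMax.odd {H w : ℤ → ℤ} (hH : IsPrefix H w) {t : ℤ} (h : FirstMax H (2 * t + 1)) :
    0 < w (2 * t + 1) ∧ 0 < w (2 * t) + w (2 * t + 1) := by
  have e1 := hH (2 * t)
  have e2 := hH (2 * t + 1)
  have e3 := h.1 (2 * t - 1) (by omega)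
  have e4 := h.1 (2 * t) (by omega)
  rw [add_sub_cancel_right] at e2
  omega

lemma FirstMax.pos {H w : ℤ → ℤ} (hH : IsPrefix H w) {p : ℤ} (h : FirstMax H p) : 0 < w p := by
  have e1 := hH p
  have e2 := h.1 (p - 1) (by omega)
  omega

/-- The signature for the charge `s'`, shifted by one, so that its blocks correspond to
those of the signature for the charge `s`. -/
lemma word_shift_even (h0 : s' 0 = s 0) (mu : Bipartition) (t : ℤ) :
    word e s' k0 mu (2 * t + 1) = beadSign s mu 0 (k0 + t * e) := by
  rw [word_odd, beadSign_zero_of_charge h0]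

lemma word_shift_odd (h1 : s' 1 = s 1 + e) (mu : Bipartition) (t : ℤ) :
    word e s' k0 mu (2 * t + 1 + 1) = beadSign s mu 1 (k0 + t * e) := by
  rw [show 2 * t + 1 + 1 = 2 * (t + 1) by ring, word_even,
    show k0 + (t + 1) * (e : ℤ) = k0 + t * e + e by ring, beadSign_one_of_charge h1]

lemma beadSign_eq_one_of_pos {lam : Bipartition} {c : Fin 2} {k : ℤ}
    (h : 0 < beadSign s lam c k) : beadSign s lam c k = 1 := by
  rcases beadSign_cases s lam c k with h' | h' | h' <;> omega

/-- Being a first maximum supplies the restrictions on the other letter of the block that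
`Swaps.move` requires. For component 1, the `e` by which the two charges differ is absorbed by the
shift of positions by one, so both nodes move a bead at the same content for `s`. -/
lemma UpsilonRel.addNode (h0 : s' 0 = s 0) (h1 : s' 1 = s 1 + e)
    {lam mu lam' mu' : Bipartition} (h : UpsilonRel s lam mu) {g g' : Node} {H H' : ℤ → ℤ}
    (hH : IsPrefix H (word e s k0 lam)) (hH' : IsPrefix H' (fun p => word e s' k0 mu (p + 1)))
    (hg : AddNode lam g lam') (hg' : AddNode mu g' mu')
    (hr : res e s g = (k0 : ZMod e)) (hr' : res e s' g' = (k0 : ZMod e))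
    {p p' : ℤ} (hp : pos e s k0 g = p) (hp' : pos e s' k0 g' = p' + 1)
    (hm : FirstMax H p) (hm' : FirstMax H' p') (hpp : p' / 2 = p / 2) :
    UpsilonRel s lam' mu' := by
  obtain ⟨D, h⟩ := h
  have ec := posContent_pos hr
  have ec' := posContent_pos hr'
  have ed := posComp_pos (e := e) (s := s) (k0 := k0) g
  have ed' := posComp_pos (e := e) (s := s') (k0 := k0) g'
  obtain ⟨t, ht⟩ : ∃ t, t = p / 2 := ⟨_, rfl⟩
  rw [hp] at ec ed
  rw [hp'] at ec' ed'
  have hA : content s g = k0 + t * e ∧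
      (g.comp = 1 → beadSign s lam 0 (k0 + t * e) ≤ 0) ∧
      (g.comp = 0 → 0 ≤ beadSign s lam 1 (k0 + t * e)) := by
    rcases (show p = 2 * t ∨ p = 2 * t + 1 by omega) with rfl | rfl
    · rw [← ec, ← ed, posContent_even, posComp_even]
      have := (hm.even hH).2
      rw [word_odd] at this
      exact ⟨rfl, fun _ => this, fun h => absurd h (by decide)⟩
    · rw [← ec, ← ed, posContent_odd, posComp_odd]
      have := (hm.odd hH).2
      rw [word_odd, word_even] at this
      have := beadSign_cases s lam 0 (k0 + t * e)
      exact ⟨rfl, fun h => absurd h (by decide), fun _ => by omega⟩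
  have hE : content s g' = k0 + t * e ∧
      (g'.comp = 0 → beadSign s mu 1 (k0 + t * e) ≤ 0) ∧
      (g'.comp = 1 → 0 ≤ beadSign s mu 0 (k0 + t * e)) := by
    rcases (show p' = 2 * t ∨ p' = 2 * t + 1 by omega) with rfl | rfl
    · rw [posContent_odd] at ec'
      rw [posComp_odd] at ed'
      have := (hm'.even hH').2
      simp only [word_shift_odd h1] at this
      refine ⟨?_, fun _ => this, fun h => absurd (ed'.trans h) (by decide)⟩
      -- Component 0 has the same charge in `s` and `s'`, so its content is the same for both.
      rw [ec', content, content, ← ed', h0]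
    · rw [show 2 * t + 1 + 1 = 2 * (t + 1) by ring] at ec' ed'
      rw [posContent_even] at ec'
      rw [posComp_even] at ed'
      have := (hm'.odd hH').2
      simp only [word_shift_odd h1, word_shift_even h0] at this
      have := beadSign_cases s mu 1 (k0 + t * e)
      refine ⟨?_, fun h => absurd (ed'.trans h) (by decide), fun _ => by omega⟩
      rw [content, ← ed', h1] at ec'
      rw [content, ← ed']
      linarith
  obtain ⟨hk, hA1, hA0⟩ := hA
  obtain ⟨hk', hE0, hE1⟩ := hE
  refine h.move (k0 + t * e) g.comp g'.comp ?_ ?_ ?_ ?_ ?_ ?_ ?_ ?_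
  · intro d x
    rw [hg.mem_bead_iff, hk]
  · intro d x
    rw [hg'.mem_bead_iff, hk']
  · rw [← hk]
    exact ⟨hg.mem_bead_pred, hg.notMem_bead⟩
  · rw [← hk']
    exact ⟨hg'.mem_bead_pred, hg'.notMem_bead⟩
  · intro hc hcon
    have := hA1 hc
    rw [beadSign_eq_one.2 hcon] at this
    omega
  · intro hc hcon
    have := hA0 hc
    rw [beadSign_eq_neg_one.2 hcon] at this
    omega
  · intro hc hcon
    have := hE0 hc
    rw [beadSign_eq_one.2 hcon] at this
    omega
  · intro hc hcon
    have := hE1 hc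
    rw [beadSign_eq_neg_one.2 hcon] at this
    omega

lemma Swaps.exists_firstMax (h0 : s' 0 = s 0) (h1 : s' 1 = s 1 + e) {lam mu : Bipartition}
    {D : ℤ → ℤ} (h : Swaps (bead s lam) (bead s mu) D) {H H' : ℤ → ℤ}
    (hH : IsPrefix H (word e s k0 lam)) (hH' : IsPrefix H' (fun p => word e s' k0 mu (p + 1))) :
    (∀ p, FirstMax H p → ∃ p', FirstMax H' p' ∧ p' / 2 = p / 2) ∧
      ∀ p, FirstMax H' p → ∃ p', FirstMax H p' ∧ p' / 2 = p / 2 := by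
  have a1 : ∀ t, H (2 * t) - H (2 * t - 1) = beadSign s lam 1 (k0 + t * e) := fun t => by
    rw [hH, word_even]
  have a2 : ∀ t, H (2 * t + 1) - H (2 * t) = beadSign s lam 0 (k0 + t * e) := fun t => by
    have := hH (2 * t + 1)
    rw [add_sub_cancel_right] at this
    rw [this, word_odd]
  have a3 : ∀ t, H' (2 * t) - H' (2 * t - 1) = beadSign s mu 0 (k0 + t * e) := fun t => by
    rw [hH', ← word_shift_even h0]
  have a4 : ∀ t, H' (2 * t + 1) - H' (2 * t) = beadSign s mu 1 (k0 + t * e) := fun t => by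
    have := hH' (2 * t + 1)
    rw [add_sub_cancel_right] at this
    rw [this, ← word_shift_odd h1]
  constructor
  · intro p hp
    exact FirstMax.exists_of_blocks a1 a2 a3 a4 (fun t => beadSign_cases _ _ _ _)
      (fun t => beadSign_cases _ _ _ _) (fun t => beadSign_cases _ _ _ _)
      (fun t => beadSign_cases _ _ _ _) (fun t => h.beadSign_add_eq _)
      (fun t => h.beadSign_iff _) hp
  · intro p hp
    exact FirstMax.exists_of_blocks a3 a4 a1 a2 (fun t => beadSign_cases _ _ _ _)
      (fun t => beadSign_cases _ _ _ _) (fun t => beadSign_cases _ _ _ _)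
      (fun t => beadSign_cases _ _ _ _) (fun t => (h.beadSign_add_eq _).symm)
      (fun t => (h.beadSign_iff _).symm) hp

lemma word_eq_one_of_pos {lam : Bipartition} {p : ℤ} (h : 0 < word e s k0 lam p) :
    word e s k0 lam p = 1 :=
  beadSign_eq_one_of_pos h

lemma firstMax_shift {H : ℤ → ℤ} {p : ℤ} :
    FirstMax (fun x => H (x + 1)) p ↔ FirstMax H (p + 1) := by
  constructor
  · rintro ⟨h1, h2⟩
    refine ⟨fun x hx => ?_, fun x hx => ?_⟩
    · have := h1 (x - 1) (by omega)
      simpa using this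
    · have := h2 (x - 1) (by omega)
      simpa using this
  · rintro ⟨h1, h2⟩
    exact ⟨fun x hx => h1 (x + 1) (by omega), fun x hx => h2 (x + 1) (by omega)⟩

include he in
lemma isBisim_upsilonRel (h0 : s' 0 = s 0) (h1 : s' 1 = s 1 + e) (hs : s 0 ≤ s 1) :
    IsBisim e s s' (UpsilonRel s) where
  empty := upsilonRel_empty hs
  forward := by
    intro lam mu lam' i h ha
    obtain ⟨k0, rfl⟩ := ZMod.intCast_surjective i
    obtain ⟨H, hH⟩ := exists_isPrefix (word e s k0 lam)
    obtain ⟨H', hH'⟩ := exists_isPrefix (word e s' k0 mu)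
    have hH1 : IsPrefix (fun x => H' (x + 1)) (fun p => word e s' k0 mu (p + 1)) := fun x => by
      have := hH' (x + 1)
      rwa [show x + 1 - 1 = x - 1 + 1 by ring] at this
    obtain ⟨g, hg, hr, hm⟩ := (arrow_iff he hH).1 ha
    obtain ⟨D, hD⟩ := id h
    obtain ⟨p', hm', hpp⟩ := (hD.exists_firstMax h0 h1 hH hH1).1 _ hm
    obtain ⟨g', mu', hg', hr', hp'⟩ :=
      exists_addNode_of_word he (word_eq_one_of_pos (hm'.pos hH1))
    refine ⟨mu', (arrow_iff he hH').2 ⟨g', hg', hr', ?_⟩,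
      h.addNode h0 h1 hH hH1 hg hg' hr hr' rfl hp' hm hm' hpp⟩
    rw [hp', ← firstMax_shift]
    exact hm'
  backward := by
    intro lam mu mu' i h ha
    obtain ⟨k0, rfl⟩ := ZMod.intCast_surjective i
    obtain ⟨H, hH⟩ := exists_isPrefix (word e s k0 lam)
    obtain ⟨H', hH'⟩ := exists_isPrefix (word e s' k0 mu)
    have hH1 : IsPrefix (fun x => H' (x + 1)) (fun p => word e s' k0 mu (p + 1)) := fun x => by
      have := hH' (x + 1)
      rwa [show x + 1 - 1 = x - 1 + 1 by ring] at this
    obtain ⟨g', hg', hr', hm'⟩ := (arrow_iff he hH').1 ha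
    obtain ⟨p', hp'⟩ : ∃ p', pos e s' k0 g' = p' + 1 := ⟨pos e s' k0 g' - 1, by ring⟩
    rw [hp', ← firstMax_shift] at hm'
    obtain ⟨D, hD⟩ := id h
    obtain ⟨p, hm, hpp⟩ := (hD.exists_firstMax h0 h1 hH hH1).2 _ hm'
    obtain ⟨g, lam', hg, hr, hp⟩ :=
      exists_addNode_of_word he (word_eq_one_of_pos (hm.pos hH))
    refine ⟨lam', (arrow_iff he hH).2 ⟨g, hg, hr, ?_⟩,
      h.addNode h0 h1 hH hH1 hg hg' hr hr' hp hp' hm hm' hpp.symm⟩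
    rw [hp]
    exact hm
  right_unique := UpsilonRel.right_unique
  left_unique := UpsilonRel.left_unique

end

/-! ### Matchings -/

section
variable {S : Finset ℕ × Finset ℕ} {θ θ' : ℕ → ℕ}

lemma IsMatching.mem (h : IsMatching S θ) {x : ℕ} (hx : x ∈ S.1) : θ x ∈ S.2 := (h x hx).1.1

lemma IsMatching.le (h : IsMatching S θ) {x : ℕ} (hx : x ∈ S.1) : θ x ≤ x := (h x hx).1.2.1

lemma IsMatching.injOn (h : IsMatching S θ) : Set.InjOn θ S.1 := by
  intro x hx x' hx' heq
  rcases lt_trichotomy x x' with hlt | hlt | hlt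
  · exact absurd heq ((h x' hx').1.2.2 x hx hlt)
  · exact hlt
  · exact absurd heq.symm ((h x hx).1.2.2 x' hx' hlt)

lemma IsMatching.apply_eq_self (h : IsMatching S θ) {x : ℕ} (hx : x ∈ S.1) (hx' : x ∈ S.2) :
    θ x = x := by
  refine le_antisymm (h.le hx) ((h x hx).2 ⟨hx', le_rfl, fun z hz hzx heq => ?_⟩)
  have := h.le hz
  omega

/-- This is Hall's condition for initial segments: when the greedy rule reaches `n`, fewer entries
have been used than are available up to `n`. The matching is built by extending the range of `x`
treated. -/
lemma exists_isMatching
    (hall : ∀ x, (S.1.filter (· ≤ x)).card ≤ (S.2.filter (· ≤ x)).card) :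
    ∃ θ, IsMatching S θ := by
  have key : ∀ n, ∃ θ : ℕ → ℕ, ∀ x ∈ S.1, x < n →
      IsGreatest {y | y ∈ S.2 ∧ y ≤ x ∧ ∀ x' ∈ S.1, x' < x → θ x' ≠ y} (θ x) := by
    intro n
    induction n with
    | zero => exact ⟨id, fun x _ hx => absurd hx (Nat.not_lt_zero x)⟩
    | succ n ih =>
      obtain ⟨θ, hθ⟩ := ih
      by_cases hn : n ∈ S.1
      · let F := (S.2.filter (· ≤ n)) \ ((S.1.filter (· < n)).image θ)
        have hF : F.Nonempty := by
          rw [← Finset.card_pos]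
          have h1 : (insert n (S.1.filter (· < n))).card ≤ (S.1.filter (· ≤ n)).card := by
            refine Finset.card_le_card fun x hx => ?_
            simp only [Finset.mem_insert, Finset.mem_filter] at hx ⊢
            rcases hx with rfl | hx
            · exact ⟨hn, le_rfl⟩
            · exact ⟨hx.1, hx.2.le⟩
          rw [Finset.card_insert_of_notMem (by simp)] at h1
          have h2 := hall n
          have h3 : ((S.1.filter (· < n)).image θ).card ≤ (S.1.filter (· < n)).card :=
            Finset.card_image_le
          have h4 := Finset.le_card_sdiff ((S.1.filter (· < n)).image θ) (S.2.filter (· ≤ n))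
          change 0 < ((S.2.filter (· ≤ n)) \ ((S.1.filter (· < n)).image θ)).card
          omega
        have hmemF : ∀ y, y ∈ F ↔ y ∈ S.2 ∧ y ≤ n ∧ ∀ x' ∈ S.1, x' < n → θ x' ≠ y := by
          intro y
          simp only [F, Finset.mem_sdiff, Finset.mem_filter, Finset.mem_image, not_exists,
            not_and, and_assoc]
        refine ⟨Function.update θ n (F.max' hF), fun x hx hxn => ?_⟩
        have hset : {y | y ∈ S.2 ∧ y ≤ x ∧ ∀ x' ∈ S.1, x' < x →
            Function.update θ n (F.max' hF) x' ≠ y} =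
            {y | y ∈ S.2 ∧ y ≤ x ∧ ∀ x' ∈ S.1, x' < x → θ x' ≠ y} := by
          ext y
          refine and_congr_right fun _ => and_congr_right fun _ => ?_
          refine forall₃_congr fun z _ hz => ?_
          rw [Function.update_of_ne (by omega)]
        rw [hset]
        by_cases hxn' : x = n
        · subst hxn'
          rw [Function.update_self]
          exact ⟨(hmemF _).1 (F.max'_mem hF), fun y hy => F.le_max' y ((hmemF y).2 hy)⟩
        · rw [Function.update_of_ne hxn']
          exact hθ x hx (by omega)
      · refine ⟨θ, fun x hx hxn => hθ x hx ?_⟩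
        rcases eq_or_lt_of_le (Nat.lt_succ_iff.1 hxn) with rfl | h
        · exact absurd hx hn
        · exact h
  obtain ⟨θ, hθ⟩ := key (S.1.sup id + 1)
  exact ⟨θ, fun x hx => hθ x hx (Nat.lt_succ_of_le (Finset.le_sup (f := id) hx))⟩

/-- A description of the used entries that does not mention `θ`, matching the return condition of
the height function. If `y = θ x`, the greedy choice means that every larger entry of `S.2` up to
`x` was already used, by an element of `[y, x]`, so `N = x` works. If `y` is never used, each `x` of
`S.1` in `[y, N]` has a partner above `y`, and counting these injectively excludes such an `N`. -/
lemma IsMatching.mem_image_iff (h : IsMatching S θ) (y : ℕ) :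
    y ∈ S.1.image θ ↔ y ∈ S.2 ∧ ∃ N, y ≤ N ∧
      (S.2.filter fun z => y ≤ z ∧ z ≤ N).card ≤ (S.1.filter fun z => y ≤ z ∧ z ≤ N).card := by
  constructor
  · intro hy
    obtain ⟨x, hx, rfl⟩ := Finset.mem_image.1 hy
    refine ⟨h.mem hx, x, h.le hx, ?_⟩
    refine Finset.card_le_card_of_surjOn θ fun z hz => ?_
    simp only [Finset.coe_filter, Set.mem_ofPred_eq] at hz
    by_cases hzx : z = θ x
    · exact ⟨x, by simp [hx, h.le hx], hzx.symm⟩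
    · have hnot : ¬ (z ∈ S.2 ∧ z ≤ x ∧ ∀ x' ∈ S.1, x' < x → θ x' ≠ z) := fun hz' => by
        have := (h x hx).2 hz'
        omega
      push Not at hnot
      obtain ⟨x', hx', hlt, heq⟩ := hnot hz.1 hz.2.2
      have := h.le hx'
      refine ⟨x', ?_, heq⟩
      simp only [Finset.coe_filter, Set.mem_ofPred_eq]
      exact ⟨hx', by omega, by omega⟩
  · rintro ⟨hy, N, hN, hcard⟩
    by_contra hcon
    have hne : ∀ x ∈ S.1, θ x ≠ y := fun x hx heq => hcon (Finset.mem_image.2 ⟨x, hx, heq⟩)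
    have hsub : (S.1.filter fun z => y ≤ z ∧ z ≤ N).image θ ⊆
        (S.2.filter fun z => y ≤ z ∧ z ≤ N).erase y := by
      intro z hz
      obtain ⟨x, hx, rfl⟩ := Finset.mem_image.1 hz
      rw [Finset.mem_filter] at hx
      rw [Finset.mem_erase, Finset.mem_filter]
      have h1 := (h x hx.1).2 ⟨hy, hx.2.1, fun x' hx' _ => hne x' hx'⟩
      have h2 := h.le hx.1
      exact ⟨hne x hx.1, h.mem hx.1, h1, by omega⟩
    have h1 := Finset.card_le_card hsub
    rw [Finset.card_image_of_injOn (h.injOn.mono fun x hx => (Finset.mem_filter.1 hx).1),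
      Finset.card_erase_of_mem (by simp [hy, hN])] at h1
    have h2 : 0 < (S.2.filter fun z => y ≤ z ∧ z ≤ N).card :=
      Finset.card_pos.2 ⟨y, by simp [hy, hN]⟩
    omega

/-- Entries with `θ x = x` may be treated as exchanged with themselves, so the new first row is the
whole image of `θ`. -/
lemma swapPairs_fst (S : Finset ℕ × Finset ℕ) (θ : ℕ → ℕ) :
    (swapPairs S θ).1 = S.1.image θ := by
  ext y
  simp only [swapPairs, pairTops, Finset.mem_union, Finset.mem_sdiff, Finset.mem_filter,
    Finset.mem_image]
  constructor
  · rintro (⟨h1, h2⟩ | ⟨x, hx, rfl⟩)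
    · exact ⟨y, h1, by_contra fun h => h2 ⟨h1, h⟩⟩
    · exact ⟨x, hx.1, rfl⟩
  · rintro ⟨x, hx, rfl⟩
    by_cases h : θ x = x
    · left
      rw [h]
      exact ⟨hx, fun h' => h'.2 h⟩
    · exact Or.inr ⟨x, ⟨hx, h⟩, rfl⟩

lemma IsMatching.swapPairs_add (h : IsMatching S θ) (y : ℕ) :
    ind (y ∈ (swapPairs S θ).1) + ind (y ∈ (swapPairs S θ).2) = ind (y ∈ S.1) + ind (y ∈ S.2) := by
  have h2 : y ∈ (swapPairs S θ).2 ↔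
      (y ∈ S.2 ∧ y ∉ (pairTops S θ).image θ) ∨ (y ∈ S.1 ∧ ¬ θ y = y) := by
    simp only [swapPairs, pairTops, Finset.mem_union, Finset.mem_sdiff, Finset.mem_filter, ne_eq]
  have h3 : y ∈ (pairTops S θ).image θ ↔ y ∈ S.1.image θ ∧ ¬ (y ∈ S.1 ∧ θ y = y) := by
    simp only [pairTops, Finset.mem_image, Finset.mem_filter]
    constructor
    · rintro ⟨x, ⟨hx, hne⟩, rfl⟩
      refine ⟨⟨x, hx, rfl⟩, ?_⟩
      rintro ⟨h4, h5⟩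
      exact hne (h.injOn h4 hx h5)
    · rintro ⟨⟨x, hx, rfl⟩, hne⟩
      refine ⟨x, ⟨hx, fun heq => hne ?_⟩, rfl⟩
      rw [heq]
      exact ⟨hx, heq⟩
  have h4 : y ∈ S.1.image θ → y ∈ S.2 := by
    intro hy
    obtain ⟨x, hx, rfl⟩ := Finset.mem_image.1 hy
    exact h.mem hx
  have h5 : y ∈ S.1 → y ∈ S.2 → θ y = y := h.apply_eq_self
  have h6 : y ∈ S.1 → θ y = y → y ∈ S.2 ∧ y ∈ S.1.image θ := fun hy heq =>
    ⟨heq ▸ h.mem hy, Finset.mem_image.2 ⟨y, hy, heq⟩⟩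
  rw [swapPairs_fst, ind_congr h2, ind_congr (or_congr (and_congr_right fun _ => not_congr h3)
    Iff.rfl)]
  generalize (y ∈ S.1.image θ) = P at *
  generalize (y ∈ S.1) = P1 at *
  generalize (y ∈ S.2) = P2 at *
  generalize (θ y = y) = P3 at *
  clear h2 h3
  grind [ind]

/-- The first row is the set of used entries, which is independent of `θ`, and the number of
occurrences of each entry then fixes the second row. -/
lemma IsMatching.swapPairs_eq (h : IsMatching S θ) (h' : IsMatching S θ') :
    swapPairs S θ = swapPairs S θ' := by
  have h1 : (swapPairs S θ).1 = (swapPairs S θ').1 := by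
    ext y
    rw [swapPairs_fst, swapPairs_fst, h.mem_image_iff, h'.mem_image_iff]
  refine Prod.ext h1 ?_
  ext y
  apply ind_inj
  have e1 := h.swapPairs_add y
  have e2 := h'.swapPairs_add y
  rw [h1] at e1
  omega

end

/-! ### Symbols and Maya diagrams -/

lemma rowLen_eq_zero {nu : YoungDiagram} {j : ℕ} (h : nu.colLen 0 ≤ j) : nu.rowLen j = 0 := by
  by_contra hne
  have h1 : (j, 0) ∈ nu := YoungDiagram.mem_iff_lt_rowLen.2 (Nat.pos_of_ne_zero hne)
  have := YoungDiagram.mem_iff_lt_colLen.1 h1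
  omega

lemma rowLen_pos {nu : YoungDiagram} {j : ℕ} (h : j < nu.colLen 0) : 0 < nu.rowLen j :=
  YoungDiagram.mem_iff_lt_rowLen.1 (YoungDiagram.mem_iff_lt_colLen.2 h)

lemma mem_betaSet_iff {nu : YoungDiagram} {K : ℕ} (hK : nu.colLen 0 < K) (y : ℕ) :
    y ∈ betaSet nu K ↔ (y : ℤ) - K ∈ maya nu := by
  simp only [betaSet, Finset.mem_image, Finset.mem_range]
  constructor
  · rintro ⟨i, hi, rfl⟩
    exact ⟨i, by omega⟩
  · rintro ⟨i, hi⟩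
    have hiK : i < K := by
      by_contra hle
      rw [rowLen_eq_zero (show nu.colLen 0 ≤ i by omega)] at hi
      omega
    exact ⟨i, hiK, by omega⟩

lemma colLen_lt_iff (nu : YoungDiagram) (K : ℕ) :
    nu.colLen 0 < K ↔ ∀ z : ℤ, z ≤ -K → z ∈ maya nu := by
  constructor
  · intro h z hz
    refine ⟨(-z - 1).toNat, ?_⟩
    rw [rowLen_eq_zero (by omega)]
    omega
  · intro h
    by_contra hle
    -- The number `-(nu.colLen 0)` is a gap of the Maya diagram: nonempty rows lie above it and
    -- empty rows below.
    obtain ⟨j, hj⟩ := h (-(nu.colLen 0 : ℤ)) (by omega)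
    rcases lt_or_ge j (nu.colLen 0) with hlt | hge
    · have := rowLen_pos hlt
      omega
    · rw [rowLen_eq_zero hge] at hj
      omega

section
variable {s0 s1 m : ℕ} {lam mu : Bipartition}

lemma admissible_iff :
    Admissible s0 s1 m lam ↔ ∀ c, ∀ z : ℤ, z ≤ -m → z ∈ bead ![(s0 : ℤ), s1] lam c := by
  unfold Admissible
  rw [colLen_lt_iff, colLen_lt_iff, Fin.forall_fin_two]
  refine and_congr ?_ ?_
  · constructor
    · intro h z hz
      exact h _ (by simp; omega)
    · intro h z hz
      have := h (z + s0) (by omega)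
      simpa [bead] using this
  · constructor
    · intro h z hz
      exact h _ (by simp; omega)
    · intro h z hz
      have := h (z + s1) (by omega)
      simpa [bead] using this

lemma mem_symbol_fst (h : Admissible s0 s1 m lam) (y : ℕ) :
    y ∈ (symbol s0 s1 m lam).1 ↔ (y : ℤ) - m ∈ bead ![(s0 : ℤ), s1] lam 0 := by
  change y ∈ betaSet (lam 0) (m + s0) ↔ (y : ℤ) - m - s0 ∈ maya (lam 0)
  rw [mem_betaSet_iff h.1, Nat.cast_add, sub_sub]

lemma mem_symbol_snd (h : Admissible s0 s1 m lam) (y : ℕ) :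
    y ∈ (symbol s0 s1 m lam).2 ↔ (y : ℤ) - m ∈ bead ![(s0 : ℤ), s1] lam 1 := by
  change y ∈ betaSet (lam 1) (m + s1) ↔ (y : ℤ) - m - s1 ∈ maya (lam 1)
  rw [mem_betaSet_iff h.2, Nat.cast_add, sub_sub]

lemma symbol_injective (h : Admissible s0 s1 m lam) (h' : Admissible s0 s1 m mu)
    (heq : symbol s0 s1 m lam = symbol s0 s1 m mu) : lam = mu := by
  refine bead_injective ![(s0 : ℤ), s1] fun c k => ?_
  rcases le_or_gt k (-m) with hk | hk
  · exact iff_of_true (admissible_iff.1 h c k hk) (admissible_iff.1 h' c k hk)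
  · obtain ⟨y, hy⟩ : ∃ y : ℕ, (y : ℤ) - m = k := ⟨(k + m).toNat, by omega⟩
    rw [← hy]
    revert c
    rw [Fin.forall_fin_two]
    refine ⟨?_, ?_⟩
    · rw [← mem_symbol_fst h, ← mem_symbol_fst h', heq]
    · rw [← mem_symbol_snd h, ← mem_symbol_snd h', heq]

lemma card_filter_Icc (T : Finset ℕ) (y n : ℕ) :
    (((T.filter fun z => y ≤ z ∧ z ≤ y + (n + 1)).card : ℕ) : ℤ) =
      (T.filter fun z => y ≤ z ∧ z ≤ y + n).card + ind (y + (n + 1) ∈ T) := by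
  by_cases h : y + (n + 1) ∈ T
  · have : (T.filter fun z => y ≤ z ∧ z ≤ y + (n + 1)) =
        insert (y + (n + 1)) (T.filter fun z => y ≤ z ∧ z ≤ y + n) := by
      ext z
      simp only [Finset.mem_filter, Finset.mem_insert]
      constructor
      · rintro ⟨h1, h2, h3⟩
        by_cases hz : z = y + (n + 1)
        · exact Or.inl hz
        · exact Or.inr ⟨h1, h2, by omega⟩
      · rintro (rfl | ⟨h1, h2, h3⟩)
        · exact ⟨h, by omega, le_rfl⟩
        · exact ⟨h1, h2, by omega⟩
    rw [this, Finset.card_insert_of_notMem (by simp), ind_of h]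
    push_cast
    ring
  · rw [ind_of_not h, add_zero]
    congr 2
    ext z
    simp only [Finset.mem_filter]
    refine and_congr_right fun hz => and_congr_right fun _ => ?_
    have : z ≠ y + (n + 1) := fun h' => h (h' ▸ hz)
    omega

/-- The symbol entry `y` is the bead `y - m` in both rows, so counting entries in an interval sums
the steps of `D`. -/
lemma IsHeight.card_sub_card {D : ℤ → ℤ} (hD : IsHeight (bead ![(s0 : ℤ), s1] lam) D)
    (h : Admissible s0 s1 m lam) {y N : ℕ} (hN : y ≤ N) :
    ((((symbol s0 s1 m lam).2.filter fun z => y ≤ z ∧ z ≤ N).card : ℕ) : ℤ) -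
      ((symbol s0 s1 m lam).1.filter fun z => y ≤ z ∧ z ≤ N).card =
      D (N - m) - D (y - m - 1) := by
  obtain ⟨n, rfl⟩ := Nat.exists_eq_add_of_le hN
  clear hN
  induction n with
  | zero =>
    have hcard : ∀ T : Finset ℕ,
        (((T.filter fun z => y ≤ z ∧ z ≤ y + 0).card : ℕ) : ℤ) = ind (y ∈ T) := by
      intro T
      by_cases hy : y ∈ T
      · have : (T.filter fun z => y ≤ z ∧ z ≤ y + 0) = {y} := by
          ext z
          simp only [Finset.mem_filter, Finset.mem_singleton]
          constructor
          · rintro ⟨-, h1, h2⟩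
            omega
          · rintro rfl
            exact ⟨hy, le_rfl, le_rfl⟩
        rw [this, ind_of hy]
        simp
      · have : (T.filter fun z => y ≤ z ∧ z ≤ y + 0) = ∅ := by
          ext z
          simp only [Finset.mem_filter, Finset.notMem_empty, iff_false]
          rintro ⟨h0, h1, h2⟩
          exact hy ((show z = y by omega) ▸ h0)
        rw [this, ind_of_not hy]
        simp
    rw [hcard, hcard, ind_congr (mem_symbol_fst h y), ind_congr (mem_symbol_snd h y)]
    exact (hD.step _).symm
  | succ n ih =>
    rw [card_filter_Icc, card_filter_Icc, ind_congr (mem_symbol_fst h _),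
      ind_congr (mem_symbol_snd h _)]
    have h1 := hD.step ((y + (n + 1) : ℕ) - m : ℤ)
    have h2 : ((y + (n + 1) : ℕ) : ℤ) - m - 1 = (y + n : ℕ) - m := by
      push_cast
      ring
    rw [h2] at h1
    omega

/-- For an admissible `m` both components are full up to `-m`, so `D` is constant there and keeps
its value `0` at `-∞`. -/
lemma IsHeight.eq_zero {D : ℤ → ℤ} (hD : IsHeight (bead ![(s0 : ℤ), s1] lam) D)
    (h : Admissible s0 s1 m lam) : D (-m - 1) = 0 := by
  obtain ⟨a, ha⟩ := hD.zero
  have key : ∀ k, min a (-m) - 1 ≤ k → k ≤ -m → D k = 0 := by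
    intro k hk
    induction k, hk using Int.leInduction with
    | base =>
      intro _
      exact ha _ (by omega)
    | succ n hn ih =>
      intro hle
      have h1 := hD.step (n + 1)
      rw [add_sub_cancel_right, ind_of (admissible_iff.1 h 0 _ hle),
        ind_of (admissible_iff.1 h 1 _ hle), ih (by omega)] at h1
      omega
  exact key _ (by omega) (by omega)

/-- Nonnegativity of `D` is Hall's condition for the symbol, and the return condition of `D` is the
criterion for being used by the matching. The shift stays admissible for `mu` because a position
full in both components remains so. -/
lemma UpsilonRel.isUpsilon (h : UpsilonRel ![(s0 : ℤ), s1] lam mu)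
    (hm : Admissible s0 s1 m lam) : IsUpsilon s0 s1 m lam mu := by
  obtain ⟨D, h⟩ := h
  have hm' : Admissible s0 s1 m mu := by
    rw [admissible_iff] at hm ⊢
    intro c z hz
    have e1 := h.add_eq z
    rw [ind_of (hm 0 z hz), ind_of (hm 1 z hz)] at e1
    revert c
    rw [Fin.forall_fin_two]
    have e2 := ind_cases (z ∈ bead ![(s0 : ℤ), s1] mu 0)
    have e3 := ind_cases (z ∈ bead ![(s0 : ℤ), s1] mu 1)
    constructor
    · by_contra hcon
      rw [ind_of_not hcon] at e1
      omega
    · by_contra hcon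
      rw [ind_of_not hcon] at e1
      omega
  refine ⟨hm, hm', ?_⟩
  obtain ⟨θ, hθ⟩ := exists_isMatching (S := symbol s0 s1 m lam) (by
    intro x
    have h1 := h.toIsHeight.card_sub_card hm (Nat.zero_le x)
    simp only [Nat.zero_le, true_and] at h1
    have h2 := h.toIsHeight.eq_zero hm
    have h3 := h.nonneg (x - m)
    rw [show ((0 : ℕ) : ℤ) - m - 1 = -m - 1 by simp] at h1
    omega)
  refine ⟨θ, hθ, ?_⟩
  have h1 : ∀ y, y ∈ (symbol s0 s1 m mu).1 ↔ y ∈ (swapPairs (symbol s0 s1 m lam) θ).1 := by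
    intro y
    rw [swapPairs_fst, hθ.mem_image_iff, mem_symbol_fst hm', h.mem_zero, mem_symbol_snd hm]
    refine and_congr_right fun _ => ?_
    constructor
    · rintro ⟨N, hN, hD⟩
      refine ⟨(N + m).toNat, by omega, ?_⟩
      have h2 := h.toIsHeight.card_sub_card hm (show y ≤ (N + m).toNat by omega)
      rw [show (((N + m).toNat : ℕ) : ℤ) - m = N by omega] at h2
      omega
    · rintro ⟨N, hN, hcard⟩
      have h2 := h.toIsHeight.card_sub_card hm hN
      exact ⟨N - m, by omega, by omega⟩
  refine Prod.ext (Finset.ext h1) (Finset.ext fun y => ?_)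
  apply ind_inj
  have e1 := hθ.swapPairs_add y
  have e2 := h.add_eq (y - m)
  rw [ind_congr (mem_symbol_fst hm y), ind_congr (mem_symbol_snd hm y),
    ind_congr (h1 y).symm, ind_congr (mem_symbol_fst hm' y)] at e1
  rw [ind_congr (mem_symbol_snd hm' y)]
  omega

lemma IsUpsilon.right_unique {mu' : Bipartition} (h : IsUpsilon s0 s1 m lam mu)
    (h' : IsUpsilon s0 s1 m lam mu') : mu = mu' := by
  obtain ⟨-, h1, θ, hθ, h2⟩ := h
  obtain ⟨-, h1', θ', hθ', h2'⟩ := h'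
  refine symbol_injective h1 h1' ?_
  rw [h2, h2', hθ.swapPairs_eq hθ']

end

/-! ### Shifts and exchanges of components -/

section
variable {e : ℕ} (he : 1 < e) {s s' : Fin 2 → ℤ}

lemma Arrow.shift {t : ℤ} (hs : ∀ c, s' c = s c + t * e) {i : ZMod e} {lam mu : Bipartition}
    (h : Arrow e s i lam mu) : Arrow e s' i lam mu := by
  have hcontent : ∀ g, content s' g = content s g + t * e := fun g => by
    simp only [content, hs]
    ring
  have hres : res e s' = res e s := by
    funext g
    simp [res, hcontent]
  have hlt : nodeLT s' = nodeLT s := by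
    funext g g'
    simp [nodeLT, hcontent]
  simpa only [Arrow, IsGood, IsNormal, IsRemovable, IsAddable, hres, hlt] using h

/-- The exchange of the two components of a bipartition. -/
def exchange (lam : Bipartition) : Bipartition := ![lam 1, lam 0]

lemma exchange_exchange (lam : Bipartition) : exchange (exchange lam) = lam := by
  funext c
  fin_cases c <;> rfl

lemma exchange_apply (lam : Bipartition) (c : Fin 2) : exchange lam c = lam (1 - c) := by
  fin_cases c <;> rfl

lemma AddNode.exchange {lam mu : Bipartition} {g : Node} (h : AddNode lam g mu) :
    AddNode (exchange lam) ⟨g.row, g.col, 1 - g.comp⟩ (exchange mu) := by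
  rw [addNode_iff] at h ⊢
  simp only [exchange_apply, sub_sub_cancel]
  refine ⟨h.1, h.2.1, fun c j hcj => h.2.2 _ _ ?_⟩
  rintro ⟨h1, h2⟩
  exact hcj ⟨by rw [← h1, sub_sub_cancel], h2⟩

lemma beadSign_exchange_zero (h0 : s' 0 = s 1) (lam : Bipartition) (k : ℤ) :
    beadSign s' (exchange lam) 0 k = beadSign s lam 1 k := by
  simp only [beadSign, bead, h0]
  rfl

lemma beadSign_exchange_one (h1 : s' 1 = s 0 + e) (lam : Bipartition) (k : ℤ) :
    beadSign s' (exchange lam) 1 (k + e) = beadSign s lam 0 k := by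
  unfold beadSign
  congr 1
  · refine ind_congr ?_
    change k + e - 1 - s' 1 ∈ maya (lam 0) ↔ k - 1 - s 0 ∈ maya (lam 0)
    rw [h1, show k + e - 1 - (s 0 + e) = k - 1 - s 0 by ring]
  · refine ind_congr ?_
    change k + e - s' 1 ∈ maya (lam 0) ↔ k - s 0 ∈ maya (lam 0)
    rw [h1, show k + e - (s 0 + e) = k - s 0 by ring]

/-- Component 0 becomes component 1 one block later and component 1 becomes component 0 of the same
block, so each letter moves by exactly one position. -/
lemma word_exchange (h0 : s' 0 = s 1) (h1 : s' 1 = s 0 + e) (k0 : ℤ) (lam : Bipartition)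
    (p : ℤ) : word e s' k0 (exchange lam) (p + 1) = word e s k0 lam p := by
  obtain ⟨t, rfl | rfl⟩ : ∃ t, p = 2 * t ∨ p = 2 * t + 1 := ⟨p / 2, by omega⟩
  · rw [word_odd, word_even, beadSign_exchange_zero h0]
  · rw [show 2 * t + 1 + 1 = 2 * (t + 1) by ring, word_even, word_odd,
      show k0 + (t + 1) * (e : ℤ) = k0 + t * e + e by ring, beadSign_exchange_one h1]

include he in
lemma Arrow.exchange (h0 : s' 0 = s 1) (h1 : s' 1 = s 0 + e) {i : ZMod e} {lam mu : Bipartition}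
    (h : Arrow e s i lam mu) : Arrow e s' i (exchange lam) (exchange mu) := by
  obtain ⟨k0, rfl⟩ := ZMod.intCast_surjective i
  obtain ⟨H, hH⟩ := exists_isPrefix (word e s' k0 (UglovCrystal.exchange lam))
  have hH1 : IsPrefix (fun x => H (x + 1)) (word e s k0 lam) := fun x => by
    have := hH (x + 1)
    rw [word_exchange h0 h1] at this
    rwa [show x + 1 - 1 = x - 1 + 1 by ring] at this
  obtain ⟨g, hg, hr, hm⟩ := (arrow_iff he hH1).1 h
  have hcomp := posComp_pos (e := e) (s := s) (k0 := k0) g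
  have hcont := posContent_pos hr
  obtain ⟨t, ht⟩ : ∃ t, pos e s k0 g = 2 * t ∨ pos e s k0 g = 2 * t + 1 :=
    ⟨pos e s k0 g / 2, by omega⟩
  rw [firstMax_shift] at hm
  have hc : 1 - g.comp = posComp (pos e s k0 g + 1) ∧
      content s' ⟨g.row, g.col, 1 - g.comp⟩ = posContent e k0 (pos e s k0 g + 1) := by
    rcases ht with ht | ht
    · rw [ht] at hcomp hcont ⊢
      rw [posComp_even] at hcomp
      rw [posContent_even] at hcont
      rw [posComp_odd, posContent_odd, hcont, content, content, ← hcomp]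
      simp [h0]
    · rw [ht] at hcomp hcont ⊢
      rw [posComp_odd] at hcomp
      rw [posContent_odd] at hcont
      rw [show 2 * t + 1 + 1 = 2 * (t + 1) by ring, posComp_even, posContent_even,
        show k0 + (t + 1) * (e : ℤ) = k0 + t * e + e by ring, hcont, content, content, ← hcomp]
      simp [h1]
      ring
  refine (arrow_iff he hH).2 ⟨_, hg.exchange, res_eq_of_content hc.2, ?_⟩
  rw [pos_eq he hc.1 hc.2]
  exact hm

lemma isBisim_shift {t : ℤ} (hs : ∀ c, s' c = s c + t * e) :
    IsBisim e s s' (fun lam mu => mu = lam) where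
  empty := rfl
  forward := by
    rintro lam mu lam' i rfl ha
    exact ⟨_, ha.shift hs, rfl⟩
  backward := by
    rintro lam mu mu' i rfl ha
    exact ⟨_, ha.shift (t := -t) fun c => by rw [hs]; ring, rfl⟩
  right_unique h h' := h.trans h'.symm
  left_unique h h' := h.symm.trans h'

include he in
lemma isBisim_exchange (h0 : s' 0 = s 1) (h1 : s' 1 = s 0 + e) :
    IsBisim e s s' (fun lam mu => mu = exchange lam) where
  empty := by
    funext c
    fin_cases c <;> rfl
  forward := by
    rintro lam mu lam' i rfl ha
    exact ⟨_, ha.exchange he h0 h1, rfl⟩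
  backward := by
    rintro lam mu mu' i rfl ha
    -- Exchanging twice shifts both charges by `e`; shifting back by `-e` yields the inverse.
    have h2 := (ha.exchange he (s' := ![s' 1, s' 0 + e]) rfl rfl).shift (s' := s) (t := -1) (by
      rw [Fin.forall_fin_two]
      simp [h0, h1])
    rw [exchange_exchange] at h2
    exact ⟨_, h2, (exchange_exchange _).symm⟩
  right_unique h h' := h.trans h'.symm
  left_unique {lam lam' _} h h' := by
    rw [← exchange_exchange lam, ← h, h', exchange_exchange]

end

/-! ### Composites of explicit bijections -/

/-- The crystals of charges `s` and `s'` are in a correspondence given by a composite of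
explicit maps. -/
def Connected (e : ℕ) (s s' : Fin 2 → ℤ) : Prop :=
  ∃ R, IsBisim e s s' R ∧ ∀ n (f : UglovSet e n s ≃ UglovSet e n s'),
    (∀ lam : UglovSet e n s, R lam (f lam)) → IsExplicit e n s s' f

section
variable {e : ℕ} (he : 1 < e) {s s' s'' : Fin 2 → ℤ}

lemma Connected.symm (h : Connected e s s') : Connected e s' s := by
  obtain ⟨R, h1, h2⟩ := h
  refine ⟨_, h1.flip, fun n f hf => ?_⟩
  refine IsExplicit.symm (h2 n f.symm fun lam => ?_)
  have := hf (f.symm lam)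
  rwa [f.apply_symm_apply] at this

lemma Connected.trans (h : Connected e s s') (h' : Connected e s' s'') : Connected e s s'' := by
  obtain ⟨R, h1, h2⟩ := h
  obtain ⟨R', h1', h2'⟩ := h'
  refine ⟨_, h1.comp h1', fun n f hf => ?_⟩
  -- A bijection compatible with the composite correspondence is determined by it, hence it factors
  -- through the middle charge.
  have : f = (h1.equiv n).trans (h1'.equiv n) := by
    ext1 lam
    exact Subtype.ext ((h1.comp h1').right_unique (hf lam)
      ⟨_, h1.rel_equiv n lam, h1'.rel_equiv n (h1.equiv n lam)⟩)
  rw [this]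
  exact (h2 n _ (h1.rel_equiv n)).trans (h2' n _ (h1'.rel_equiv n))

lemma connected_shift (a b t : ℤ) : Connected e ![a, b] ![a + t * e, b + t * e] := by
  refine ⟨_, isBisim_shift (t := t) ?_, fun n f hf => ?_⟩
  · rw [Fin.forall_fin_two]
    exact ⟨rfl, rfl⟩
  · exact IsExplicit.shift ![a, b] t f hf

include he

lemma connected_exchange (a b : ℤ) : Connected e ![a, b] ![b, a + e] := by
  refine ⟨_, isBisim_exchange he rfl rfl, fun n f hf => ?_⟩
  exact IsExplicit.exchange ![a, b] f hf

lemma connected_upsilon_nat (a b : ℕ) (hab : a ≤ b) :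
    Connected e ![(a : ℤ), b] ![(a : ℤ), b + e] := by
  refine ⟨_, isBisim_upsilonRel he rfl rfl (by simpa using hab), fun n f hf => ?_⟩
  exact IsExplicit.upsilon a b hab f fun lam m hm => (hf lam).isUpsilon hm

/-- Negative charges are reduced to natural ones by conjugating with a shift by `|a| * e`, which
makes both charges nonnegative. -/
lemma connected_upsilon (a b : ℤ) (hab : a ≤ b) : Connected e ![a, b] ![a, b + e] := by
  have hpos : 0 ≤ a + |a| * e := by
    have h1 : |a| * 1 ≤ |a| * e := mul_le_mul_of_nonneg_left (by omega) (abs_nonneg a)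
    have h2 := neg_abs_le a
    omega
  obtain ⟨c, hc⟩ := Int.eq_ofNat_of_zero_le hpos
  obtain ⟨d, hd⟩ := Int.eq_ofNat_of_zero_le (show 0 ≤ b + |a| * e by omega)
  have h1 := connected_shift (e := e) a b |a|
  have h2 := connected_shift (e := e) a (b + e) |a|
  rw [show b + e + |a| * e = b + |a| * e + e by ring] at h2
  rw [hc, hd] at h1 h2
  exact (h1.trans (connected_upsilon_nat he c d (by omega))).trans h2.symm

lemma connected_add_snd (a b : ℤ) : Connected e ![a, b] ![a, b + e] := by
  rcases le_total a b with hab | hab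
  · exact connected_upsilon he a b hab
  · have h1 := connected_exchange he b a
    have h2 := connected_upsilon he b a hab
    have h3 := connected_exchange he a b
    have h4 := connected_exchange he b (a + e)
    have h5 := connected_shift (e := e) a b 1
    rw [one_mul] at h5
    -- The chain used for `b ≤ a` is `(a, b)`, `(a + e, b + e)`, `(b, a + e)`, `(b, a)`, `(a, b +
    -- e)`, whose middle step is the inverse of `Υ` for the ordered charge `(b, a)`.
    have h6 := h3.trans (h4.trans (connected_shift (a + e) (b + e) 0))
    exact h5.trans (h4.symm.trans (h2.symm.trans h1))

lemma connected_add_mul_snd (a b t : ℤ) : Connected e ![a, b] ![a, b + t * e] := by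
  have hnat : ∀ (n : ℕ) (b : ℤ), Connected e ![a, b] ![a, b + n * e] := by
    intro n
    induction n with
    | zero =>
      intro b
      have := connected_shift (e := e) a b 0
      simpa using this
    | succ n ih =>
      intro b
      have := (ih b).trans (connected_add_snd he a (b + n * e))
      rwa [show b + n * e + e = b + ((n + 1 : ℕ) : ℤ) * e by push_cast; ring] at this
  rcases le_total 0 t with ht | ht
  · obtain ⟨n, rfl⟩ := Int.eq_ofNat_of_zero_le ht
    exact hnat n b
  · obtain ⟨n, hn⟩ := Int.eq_ofNat_of_zero_le (show 0 ≤ -t by omega)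
    have := (hnat n (b + t * e)).symm
    rwa [← hn, show b + t * e + -t * e = b by ring] at this

lemma connected_add_mul (a b t u : ℤ) : Connected e ![a, b] ![a + t * e, b + u * e] := by
  have h1 := connected_shift (e := e) a b t
  have h2 := connected_add_mul_snd he (a + t * e) (b + t * e) (u - t)
  rw [show b + t * e + (u - t) * e = b + u * e by ring] at h2
  exact h1.trans h2

lemma connected_of_linked (h : Linked e s s') : Connected e s s' := by
  have hs : ∀ r : Fin 2 → ℤ, r = ![r 0, r 1] := fun r => by
    funext c
    fin_cases c <;> rfl
  rw [hs s, hs s']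
  rcases h with ⟨h0, h1⟩ | ⟨h0, h1⟩
  · obtain ⟨t, ht⟩ := h0.symm.dvd
    obtain ⟨u, hu⟩ := h1.symm.dvd
    have := connected_add_mul he (s 0) (s 1) t u
    rwa [show s 0 + t * e = s' 0 by linarith, show s 1 + u * e = s' 1 by linarith] at this
  · obtain ⟨t, ht⟩ := h0.symm.dvd
    obtain ⟨u, hu⟩ := h1.symm.dvd
    -- The exchange has already added one `e` to `s 0`, hence `u - 1`.
    have := (connected_exchange he (s 0) (s 1)).trans
      (connected_add_mul he (s 1) (s 0 + e) t (u - 1))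
    rwa [show s 1 + t * e = s' 0 by linarith, show s 0 + e + (u - 1) * e = s' 1 by linarith]
      at this

end

end UglovCrystal

/-! ### The theorem -/

theorem theorem4p1 (e : ℕ) (he : 1 < e) (n : ℕ) :
    (∀ s0 s1 : ℕ, s0 ≤ s1 →
      ∃ Psi : UglovCrystal.UglovSet e n ![(s0 : ℤ), s1] ≃
          UglovCrystal.UglovSet e n ![(s0 : ℤ), s1 + e],
        UglovCrystal.IsCrystalBijection e n ![(s0 : ℤ), s1] ![(s0 : ℤ), s1 + e] Psi ∧
        ∀ (lam : UglovCrystal.UglovSet e n ![(s0 : ℤ), s1]) (m : ℕ),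
          UglovCrystal.Admissible s0 s1 m lam →
          ∀ mu : UglovCrystal.Bipartition,
            UglovCrystal.IsUpsilon s0 s1 m lam mu ↔
              (Psi lam : UglovCrystal.Bipartition) = mu) ∧
    (∀ s s' : Fin 2 → ℤ, UglovCrystal.Linked e s s' →
      ∃ Psi : UglovCrystal.UglovSet e n s ≃ UglovCrystal.UglovSet e n s',
        UglovCrystal.IsCrystalBijection e n s s' Psi ∧
        UglovCrystal.IsExplicit e n s s' Psi) := by
  refine ⟨fun s0 s1 hs => ?_, fun s s' h => ?_⟩
  · have hb := UglovCrystal.isBisim_upsilonRel he (s := ![(s0 : ℤ), s1])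
      (s' := ![(s0 : ℤ), s1 + e]) rfl rfl (by simpa using hs)
    refine ⟨hb.equiv n, hb.isCrystalBijection he n, fun lam m hm mu => ?_⟩
    have hU := (hb.rel_equiv n lam).isUpsilon hm
    constructor
    · intro h
      exact hU.right_unique h
    · rintro rfl
      exact hU
  · obtain ⟨R, h1, h2⟩ := UglovCrystal.connected_of_linked he h
    exact ⟨h1.equiv n, h1.isCrystalBijection he n, h2 n _ (h1.rel_equiv n)⟩
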